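/- Let $n\neq 2$ be an even natural number, write $[n]=\{1,\dots,n\}$, and let $G$ be an undirected graph on the vertex set $[n]\times[n]$ each of whose edges joins a vertex of $J_1=\{1,\dots,n/2\}^2$ to a vertex of $J_2=\{n/2+1,\dots,n\}^2$. Call $G$ a Yes-instance of $(n\times n)$-BPIS if it has an independent set $S\subseteq J_1\cup J_2$ of size $n$ such that for every $i\in[n]$ there are $j,k\in[n]$ with $(i,j)\in S$ and $(k,i)\in S$. Let $\gamma_G\colon\{0,1\}^n\times\{0,1\}^n\times\{0,1\}^n\to\{0,1,*\}$ be the partial function with $$\gamma_G(x,y,z)=\begin{cases} \bigvee_{i\in[n]}(y_i\wedge z_i) & \text{if } x=0^n,\\ \bigvee_{i\in[n]} z_i & \text{if } x=1^n,\\ \bigvee_{i\in[n]}(x_i\vee y_i) & \text{if } z=1^n,\\ 0 & \text{if } z=0^n,\\ \bigvee_{i\le n/2} x_i & \text{if } z=1^{n/2}0^{n/2},\ y=0^n,\\ \bigvee_{i> n/2} x_i & \text{if } z=0^{n/2}1^{n/2},\ y=0^n,\\ 1 & \text{if } y=0^n \text{ and, for some edge } \{(j,k),(j',k')\} \text{ of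 } G \text{ with } (j,k)\in J_1,\ (j',k')\in J_2,\\ & \quad x \text{ is } 0 \text{ exactly at } k,k' \text{ and } z \text{ is } 1 \text{ exactly at } j,j',\\ * & \text{otherwise.} \end{cases}$$ (Since $n\ne 2$, overlapping cases agree.) A once-appearance branching program (oaBP) is a branching program over $\{0,1\}$ (a finite directed acyclic graph with one source, a $0$-sink and a $1$-sink, each non-sink node being labelled with a variable and having one outgoing edge for each of the values $0$ and $1$) whose non-sink nodes have pairwise distinct labels. It computes $\gamma_G$ if it computes some total Boolean function in the variables $x_1,\dots,x_n,y_1,\dots,y_n,z_1,\dots,z_n$ that agrees with $\gamma_G$ wherever $\gamma_G\neq *$. Then: 1. $G$ is a Yes-instance of $(n\times n)$-BPIS if and only if some oaBP computes $\gamma_G$. 2. Every oaBP $B$ that computes $\gamma_G$ has exactly $3n$ non-sink nodes, and there is a permutation $\pi$ of $[n]$ such that: (a) if $\ell_1,\dots,\ell_{3n}$ are the labels of the non-sink nodes of $B$ in any topological order, then for every $i\in\{0,\dots,n-1\}$ we have $\{\ell_{3i+1},\ell_{3i+2},\ell_{3i+3}\}=\{x_a,y_b,z_b\}$ for some $a,b\in[n]$,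 and for all $a,b\in[n]$ we have $\pi(b)=a$ if and only if $\{x_a,y_b,z_b\}$ is one of these triplets; (b) $\pi$ maps $\{1,\dots,n/2\}$ into itself and $\{n/2+1,\dots,n\}$ into itself; (c) $\{(i,\pi(i)) : i\in[n]\}$ is an independent set of $G$. -/

import Mathlib

/-- A (Boolean, deterministic) branching program with variables in `V`.
`Node` is the finite set of non-sink nodes; `Sum.inr b` is the sink labelled `b`, so that the
vertex set of the underlying directed graph is `Node ⊕ Bool`. Every non-sink node `u` queries the
variable `label u` and has one outgoing edge for each value `b`, namely to `next u b`. -/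
structure BranchingProgram (V : Type) where
  Node : Type
  finite_node : Finite Node
  label : Node → V
  next : Node → Bool → Node ⊕ Bool
  source : Node ⊕ Bool
  /-- The directed graph has no cycle. -/
  acyclic : ∀ u : Node, ¬ Relation.TransGen (fun v w => ∃ b, next v b = Sum.inl w) u u
  /-- There is exactly one source: a non-sink node has no incoming edge iff it is `source`.
  (A program whose source is a sink therefore has no non-sink node at all.) -/
  source_iff : ∀ u : Node, (∀ v b, next v b ≠ Sum.inl u) ↔ source = Sum.inl u

namespace BranchingProgram

variable {V : Type}

/-- One step of the computation on the assignment `a`: from a non-sink node, follow the edge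
labelled with the value of the variable queried there. -/
def Step (B : BranchingProgram V) (a : V → Bool) (p q : B.Node ⊕ Bool) : Prop :=
  ∃ u : B.Node, p = Sum.inl u ∧ q = B.next u (a (B.label u))

/-- `B` computes `f`: on every assignment `a` the computation that starts in the source
ends in the sink labelled `f a`. -/
def Computes (B : BranchingProgram V) (f : (V → Bool) → Bool) : Prop :=
  ∀ a : V → Bool, Relation.ReflTransGen (B.Step a) B.source (Sum.inr (f a))

/-- `B` is a once-appearance branching program: its nodes have distinct labels. -/
def OnceAppearance (B : BranchingProgram V) : Prop :=
  Function.Injective B.label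

/-- An enumeration of the non-sink nodes (`ord u` is the 0-based position of `u`) is a
topological order if every edge between non-sink nodes goes forward. -/
def IsTopologicalOrder (B : BranchingProgram V) {N : ℕ} (ord : B.Node ≃ Fin N) : Prop :=
  ∀ (u v : B.Node) (b : Bool), B.next u b = Sum.inl v → ord u < ord v

/-- The set of labels at the positions `3 * i`, `3 * i + 1`, `3 * i + 2` (0-based) of `ord`. -/
def blockLabels (B : BranchingProgram V) {N : ℕ} (ord : B.Node ≃ Fin N) (i : ℕ) : Set V :=
  B.label '' {u | (ord u : ℕ) / 3 = i}

/-- `B` computes some total function that extends the partial function `g`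
(`none` means that `g` is undefined, i.e. has the value `*`). -/
def ComputesExtension (B : BranchingProgram V) (g : (V → Bool) → Option Bool) : Prop :=
  ∃ f : (V → Bool) → Bool, (∀ a v, g a = some v → f a = v) ∧ B.Computes f

end BranchingProgram

/-- The first half of `[n]` (0-based); the second half is its complement. -/
def InFirstHalf {n : ℕ} (i : Fin n) : Prop := (i : ℕ) < n / 2

/-- The set of vertices `[n/2] × [n/2]`. -/
def BPIS.J₁ (n : ℕ) : Set (Fin n × Fin n) := {v | InFirstHalf v.1 ∧ InFirstHalf v.2}

/-- The set of vertices `{n/2+1, …, n} × {n/2+1, …, n}`. -/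
def BPIS.J₂ (n : ℕ) : Set (Fin n × Fin n) := {v | ¬ InFirstHalf v.1 ∧ ¬ InFirstHalf v.2}

/-- Instances of the `(n × n)`-bipartite permutation independent set problem: graphs all of whose
edges join a vertex of `J₁` and a vertex of `J₂`. -/
def BPIS.IsInstance {n : ℕ} (G : SimpleGraph (Fin n × Fin n)) : Prop :=
  ∀ u v, G.Adj u v →
    (u ∈ BPIS.J₁ n ∧ v ∈ BPIS.J₂ n) ∨ (u ∈ BPIS.J₂ n ∧ v ∈ BPIS.J₁ n)

/-- Yes-instances: there is an independent set `S ⊆ J₁ ∪ J₂` of size `n` such that the coordinates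
of its elements define a permutation of `[n]`. -/
def BPIS.IsYes {n : ℕ} (G : SimpleGraph (Fin n × Fin n)) : Prop :=
  ∃ S : Finset (Fin n × Fin n),
    (S : Set (Fin n × Fin n)) ⊆ BPIS.J₁ n ∪ BPIS.J₂ n ∧ S.card = n ∧
    G.IsIndepSet (S : Set (Fin n × Fin n)) ∧
    ∀ i : Fin n, ∃ j k : Fin n, (i, j) ∈ S ∧ (k, i) ∈ S

/-- The `3n` variables `x₁, …, xₙ, y₁, …, yₙ, z₁, …, zₙ`. -/
inductive XYZ (n : ℕ) : Type
  | x (i : Fin n) : XYZ n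
  | y (i : Fin n) : XYZ n
  | z (i : Fin n) : XYZ n

/-- The condition of the edge clause of `γ_G`: for some edge `{(j, k), (j', k')}` of `G` with
`j, k` in the first and `j', k'` in the second half, `x` is `0` exactly at `k, k'`, `y` is zero,
and `z` is `1` exactly at `j, j'`. -/
def EdgeClause {n : ℕ} (G : SimpleGraph (Fin n × Fin n)) (x y z : Fin n → Bool) : Prop :=
  ∃ j k j' k' : Fin n, (j, k) ∈ BPIS.J₁ n ∧ (j', k') ∈ BPIS.J₂ n ∧ G.Adj (j, k) (j', k') ∧
    (∀ i, x i = false ↔ i = k ∨ i = k') ∧ (∀ i, y i = false) ∧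
    (∀ i, z i = true ↔ i = j ∨ i = j')

open Classical in
/-- The partial function `γ_G`, on the three vectors `x, y, z`; `none` stands for `*`. -/
noncomputable def gammaVec {n : ℕ} (G : SimpleGraph (Fin n × Fin n)) (x y z : Fin n → Bool) :
    Option Bool :=
  if ∀ i, x i = false then some (decide (∃ i, y i = true ∧ z i = true))
  else if ∀ i, x i = true then some (decide (∃ i, z i = true))
  else if ∀ i, z i = true then some (decide (∃ i, x i = true ∨ y i = true))
  else if ∀ i, z i = false then some false
  else if (∀ i, z i = true ↔ InFirstHalf i) ∧ (∀ i, y i = false) then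
    some (decide (∃ i, InFirstHalf i ∧ x i = true))
  else if (∀ i, z i = true ↔ ¬ InFirstHalf i) ∧ (∀ i, y i = false) then
    some (decide (∃ i, ¬ InFirstHalf i ∧ x i = true))
  else if EdgeClause G x y z then some true
  else none

/-- `γ_G` as a partial function of an assignment to the `3n` variables. -/
noncomputable def gammaG {n : ℕ} (G : SimpleGraph (Fin n × Fin n)) (a : XYZ n → Bool) :
    Option Bool :=
  gammaVec G (fun i => a (XYZ.x i)) (fun i => a (XYZ.y i)) (fun i => a (XYZ.z i))

/-!
A once-appearance program that computes `γ_G` queries each of the `3n` variables, so its nodes may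
be identified with the variables. As no variable occurs twice, every computation path is
consistent, and a variable that matters for the function computed at a vertex is reachable from it.
The restrictions of `γ_G` determine the program up to a permutation.

* With `x = 0` the program computes `⋁ i, y i ∧ z i`. If the `x`-nodes are skipped along their
  `0`-edges, vertices computing the same function are equal (`EqX.skip_eq`): each of them is
  reachable from the other. Hence the two variables of each pair `y b`, `z b` are read
  consecutively, in some order of the pairs, and the `0`-edges of both lead to the next pair
  (`St.pair`, `PairChain`).
* On `(x, y, z) = (0, 0, 1)` all variables `x`, `y` matter, so this computation visits all nodes `x`
  and `y`; on `(1, 0, 0)` all variables `z` matter. Comparing these two computations shows that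
  each pair needs an `x`-node of its own (`PairChain.exists_partner`): just before `z b` if `y b` is
  read before `z b`, and just after `z b`, or after `z b` and `y b`, otherwise. No `x`-node serves two
  pairs (`PairChain.partner_inj`), and as there are `n` of both, this is a bijection `π`.
* The resulting triplets are consecutive for every topological order (`TripleChain.rank_lt`), and
  numbering then gives the blocks of three (`TripleChain.rank_div`).
* If `y = 0` and `z b ∧ x (π b)` is `0` for all `b`, the program rejects (`TripleChain.not_acc`): the
  computation passes from the entry of each triplet to that of the next. Take `z` to be the
  indicator of the first half and `x` to be `0` exactly on its image under `π`; as `γ_G` must be `0`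
  there, `π` preserves the halves. An edge between `(j, π j)` and `(j', π j')` is impossible since
  `γ_G` is `1` on the input belonging to this edge.

Conversely, if `π` preserves the halves and its graph is independent, then the once-appearance
program that evaluates `z b ∧ (x (π b) ∨ y b)` for `b = 1, …, n`, and accepts as soon as one of these is
true, computes `γ_G` (`gadgetProgram_computesExtension`).
-/

namespace OnceProgram

/-! ### Runs of branching programs whose nodes are their variables -/

section General

variable {V : Type} (nx : V → Bool → V ⊕ Bool)

/-- One computation step on the assignment `a`, for the program with node set `V` in which the
node `u` queries the variable `u` and has successors `nx u false`, `nx u true`. -/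
def Step (a : V → Bool) (p q : V ⊕ Bool) : Prop := ∃ u, p = Sum.inl u ∧ q = nx u (a u)

/-- The computation on `a` started at the vertex `p` visits the vertex `q`. -/
abbrev Run (a : V → Bool) : V ⊕ Bool → V ⊕ Bool → Prop := Relation.ReflTransGen (Step nx a)

/-- The computation on `a` started at `p` ends in the sink labelled `true`. -/
def Acc (a : V → Bool) (p : V ⊕ Bool) : Prop := Run nx a p (Sum.inr true)

/-- `r` increases strictly along the edges between nodes; such an `r` witnesses acyclicity. -/
def IsRank (r : V → ℕ) : Prop := ∀ u b v, nx u b = Sum.inl v → r u < r v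

variable {nx} {r : V → ℕ} {a a' : V → Bool}

theorem run_node (u : V) : Run nx a (Sum.inl u) (nx u (a u)) :=
  Relation.ReflTransGen.single ⟨u, rfl, rfl⟩

theorem run_next {u : V} {b : Bool} (h : a u = b) : Run nx a (Sum.inl u) (nx u b) :=
  h ▸ run_node u

theorem run_sink {c : Bool} {q : V ⊕ Bool} (h : Run nx a (Sum.inr c) q) : q = Sum.inr c := by
  rcases Relation.ReflTransGen.cases_head h with h | ⟨_, ⟨u, hu, _⟩, _⟩
  · exact h.symm
  · cases hu

theorem run_node_cases {u : V} {q : V ⊕ Bool} (h : Run nx a (Sum.inl u) q) :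
    q = Sum.inl u ∨ Run nx a (nx u (a u)) q := by
  rcases Relation.ReflTransGen.cases_head h with h | ⟨_, ⟨v, hv, rfl⟩, h⟩
  · exact Or.inl h.symm
  · cases hv; exact Or.inr h

theorem run_next_of_ne {u v : V} {b : Bool} (h : Run nx a (Sum.inl u) (Sum.inl v)) (hb : a u = b)
    (hne : u ≠ v) : Run nx a (nx u b) (Sum.inl v) := by
  rcases run_node_cases h with h | h
  · exact absurd (Sum.inl.inj h).symm hne
  · exact hb ▸ h

theorem run_total {p q q' : V ⊕ Bool} (h : Run nx a p q) (h' : Run nx a p q') :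
    Run nx a q q' ∨ Run nx a q' q := by
  refine Relation.ReflTransGen.total_of_right_unique ?_ h h'
  rintro _ _ _ ⟨u, rfl, rfl⟩ ⟨v, hv, rfl⟩
  cases hv; rfl

theorem acc_iff_of_run {p q : V ⊕ Bool} (h : Run nx a p q) : Acc nx a p ↔ Acc nx a q := by
  refine ⟨fun hp => ?_, fun hq => h.trans hq⟩
  rcases run_total h hp with h1 | h1
  · exact h1
  · rw [run_sink h1]; exact .refl

theorem acc_node {u : V} {b : Bool} (h : a u = b) :
    Acc nx a (Sum.inl u) ↔ Acc nx a (nx u b) :=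
  acc_iff_of_run (run_next h)

theorem acc_sink {c : Bool} : Acc nx a (Sum.inr c) ↔ c = true := by
  refine ⟨fun h => ?_, fun h => h ▸ .refl⟩
  have := run_sink h
  simp_all

theorem IsRank.run_lt (hr : IsRank nx r) {u v : V} {b : Bool} {p : V ⊕ Bool} (hp : nx u b = p)
    (h : Run nx a p (Sum.inl v)) : r u < r v := by
  induction h using Relation.ReflTransGen.head_induction_on generalizing u b with
  | refl => exact hr u b v hp
  | head h1 _ ih =>
    obtain ⟨w, rfl, rfl⟩ := h1
    exact (hr u b w hp).trans (ih rfl)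

theorem IsRank.eq_or_lt (hr : IsRank nx r) {u v : V} (h : Run nx a (Sum.inl u) (Sum.inl v)) :
    u = v ∨ r u < r v := by
  rcases run_node_cases h with h | h
  · exact Or.inl (Sum.inl.inj h).symm
  · exact Or.inr (hr.run_lt rfl h)

theorem IsRank.le (hr : IsRank nx r) {u v : V} (h : Run nx a (Sum.inl u) (Sum.inl v)) :
    r u ≤ r v := by
  rcases hr.eq_or_lt h with h | h
  · rw [h]
  · exact h.le

theorem run_congr {p q : V ⊕ Bool} (h : ∀ u, Run nx a p (Sum.inl u) → a u = a' u)
    (hpq : Run nx a p q) : Run nx a' p q := by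
  induction hpq with
  | refl => exact .refl
  | tail h1 h2 ih =>
    obtain ⟨u, rfl, rfl⟩ := h2
    exact ih.tail ⟨u, rfl, by rw [h u h1]⟩

theorem IsRank.run_congr_lt (hr : IsRank nx r) {p : V ⊕ Bool} {w : V}
    (h : ∀ u, r u < r w → a u = a' u) (hp : Run nx a p (Sum.inl w)) : Run nx a' p (Sum.inl w) := by
  induction hp using Relation.ReflTransGen.head_induction_on with
  | refl => exact .refl
  | head h1 h2 ih =>
    obtain ⟨u, rfl, rfl⟩ := h1
    exact ih.head ⟨u, rfl, by rw [h u (hr.run_lt rfl h2)]⟩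

theorem IsRank.acc_congr_ge (hr : IsRank nx r) {w : V} (h : ∀ u, r w ≤ r u → a u = a' u) :
    Acc nx a (Sum.inl w) ↔ Acc nx a' (Sum.inl w) :=
  ⟨run_congr fun u hu => h u (hr.le hu), run_congr fun u hu => (h u (hr.le hu)).symm⟩

theorem IsRank.acc_congr_next (hr : IsRank nx r) {w : V} (c : Bool)
    (h : ∀ u, r w < r u → a u = a' u) : Acc nx a (nx w c) ↔ Acc nx a' (nx w c) :=
  ⟨run_congr fun u hu => h u (hr.run_lt rfl hu),
    run_congr fun u hu => (h u (hr.run_lt rfl hu)).symm⟩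

/-- A variable whose value changes the outcome is queried. -/
theorem run_of_sensitive {p : V ⊕ Bool} {v : V} (h : ∀ u, u ≠ v → a u = a' u)
    (h1 : Acc nx a p) (h2 : ¬ Acc nx a' p) : Run nx a p (Sum.inl v) := by
  by_contra hv
  refine h2 (run_congr (fun u hu => h u ?_) h1)
  rintro rfl
  exact hv hu

theorem IsRank.run_of_sensitive' (hr : IsRank nx r) {p : V ⊕ Bool} {v : V}
    (h : ∀ u, u ≠ v → a u = a' u) (h1 : Acc nx a p) (h2 : ¬ Acc nx a' p) :
    Run nx a' p (Sum.inl v) := by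
  refine hr.run_congr_lt (fun u hu => h u ?_) (run_of_sensitive h h1 h2)
  rintro rfl
  exact lt_irrefl _ hu

end General

/-! ### The restriction to `x = 0` -/

section XZero

variable {n : ℕ} (nx : XYZ n → Bool → XYZ n ⊕ Bool)

/-- The variables, as a disjoint union of the three groups. -/
def xyzEquiv (n : ℕ) : XYZ n ≃ Fin n ⊕ Fin n ⊕ Fin n where
  toFun
    | .x i => Sum.inl i
    | .y i => Sum.inr (Sum.inl i)
    | .z i => Sum.inr (Sum.inr i)
  invFun
    | Sum.inl i => .x i
    | Sum.inr (Sum.inl i) => .y i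
    | Sum.inr (Sum.inr i) => .z i
  left_inv := by rintro (i | i | i) <;> rfl
  right_inv := by rintro (i | i | i) <;> rfl

instance : Finite (XYZ n) := .of_equiv _ (xyzEquiv n).symm

theorem card_xyz (n : ℕ) : Nat.card (XYZ n) = 3 * n := by
  rw [Nat.card_congr (xyzEquiv n), Nat.card_sum, Nat.card_sum, Nat.card_fin]
  omega

/-- The assignment `a` has `x = 0`. -/
def XZero (a : XYZ n → Bool) : Prop := ∀ i, a (XYZ.x i) = false

/-- With `x = 0`, the variable `v` matters for the outcome of computations started at `p`. -/
def Ess (p : XYZ n ⊕ Bool) (v : XYZ n) : Prop :=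
  ∃ a a', XZero a ∧ XZero a' ∧ (∀ u, u ≠ v → a u = a' u) ∧ Acc nx a p ∧ ¬ Acc nx a' p

/-- The vertices `p` and `q` compute the same function on the assignments with `x = 0`. -/
def EqX (p q : XYZ n ⊕ Bool) : Prop := ∀ a, XZero a → (Acc nx a p ↔ Acc nx a q)

/-- On the assignments with `x = 0`, the vertex `p` computes `⋁ i ∈ I, y i ∧ z i`. -/
def St (p : XYZ n ⊕ Bool) (I : Finset (Fin n)) : Prop :=
  ∀ a, XZero a → (Acc nx a p ↔ ∃ i ∈ I, a (XYZ.y i) = true ∧ a (XYZ.z i) = true)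

/-- The two non-`x` variables of index `b`, as a function of a Boolean, so that they can be treated
symmetrically. -/
def yz (c : Bool) (b : Fin n) : XYZ n := bif c then XYZ.y b else XYZ.z b

variable {nx} {r : XYZ n → ℕ} {a a' : XYZ n → Bool} {p q : XYZ n ⊕ Bool} {v : XYZ n}
  {I : Finset (Fin n)}

theorem yz_ne_x (c : Bool) (b i : Fin n) : yz c b ≠ XYZ.x i := by
  cases c <;> simp [yz]

theorem yz_inj {c d : Bool} {b e : Fin n} : yz c b = yz d e ↔ c = d ∧ b = e := by
  cases c <;> cases d <;> simp [yz]

theorem yz_and (c : Bool) (i : Fin n) :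
    (a (XYZ.y i) = true ∧ a (XYZ.z i) = true) ↔ (a (yz c i) = true ∧ a (yz (!c) i) = true) := by
  cases c <;> simp [yz, and_comm]

theorem eq_x_or_yz (v : XYZ n) : (∃ i, v = XYZ.x i) ∨ ∃ c b, v = yz c b := by
  rcases v with i | i | i
  · exact Or.inl ⟨i, rfl⟩
  · exact Or.inr ⟨true, i, rfl⟩
  · exact Or.inr ⟨false, i, rfl⟩

theorem Ess.run_self (hr : IsRank nx r) (h : Ess nx p v) :
    (∃ a, XZero a ∧ Run nx a p (Sum.inl v)) ∧ Ess nx (Sum.inl v) v := by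
  obtain ⟨a, a', ha, ha', hv, h1, h2⟩ := h
  have r1 := run_of_sensitive hv h1 h2
  have r2 := hr.run_of_sensitive' hv h1 h2
  exact ⟨⟨a, ha, r1⟩, a, a', ha, ha', hv, (acc_iff_of_run r1).1 h1,
    fun h => h2 ((acc_iff_of_run r2).2 h)⟩

theorem Ess.not_sink (hr : IsRank nx r) {c : Bool} (h : Ess nx (Sum.inr c) v) : False := by
  obtain ⟨a, -, ha⟩ := (h.run_self hr).1
  cases run_sink ha

theorem EqX.ess (h : EqX nx p q) (hp : Ess nx p v) : Ess nx q v := by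
  obtain ⟨a, a', ha, ha', hv, h1, h2⟩ := hp
  exact ⟨a, a', ha, ha', hv, (h a ha).1 h1, fun h3 => h2 ((h a' ha').2 h3)⟩

theorem EqX.symm (h : EqX nx p q) : EqX nx q p := fun a ha => (h a ha).symm

/-- What matters below a vertex that is visited from `p` matters at `p`: glue the
assignment leading to the vertex with the one showing that `v` matters there. -/
theorem Ess.of_run (hr : IsRank nx r) {w : XYZ n} (ha : XZero a) (h : Run nx a p (Sum.inl w))
    (hw : Ess nx (Sum.inl w) v) : Ess nx p v := by
  obtain ⟨b, b', hb, hb', hv, h1, h2⟩ := hw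
  have hwv := hr.le (run_of_sensitive hv h1 h2)
  have key : ∀ d : XYZ n → Bool,
      (Acc nx (fun u => if r u < r w then a u else d u) p ↔ Acc nx d (Sum.inl w)) := by
    intro d
    rw [acc_iff_of_run (hr.run_congr_lt (fun u hu => (if_pos hu).symm) h)]
    exact hr.acc_congr_ge fun u hu => if_neg (not_lt.2 hu)
  refine ⟨_, _, ?_, ?_, ?_, (key b).2 h1, fun h => h2 ((key b').1 h)⟩
  · intro i; dsimp only; split_ifs; exacts [ha i, hb i]
  · intro i; dsimp only; split_ifs; exacts [ha i, hb' i]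
  · intro u hu; simp only [hv u hu]

/-- From every vertex, following the `0`-edges of `x`-nodes leads to a vertex that is no
`x`-node. -/
theorem exists_skip (hr : ∃ r, IsRank nx r) (p : XYZ n ⊕ Bool) : ∃ q,
    (∀ i, q ≠ Sum.inl (XYZ.x i)) ∧
    Relation.ReflTransGen (fun p q => ∃ i, p = Sum.inl (XYZ.x i) ∧ q = nx (XYZ.x i) false) p q := by
  obtain ⟨r, hr⟩ := hr
  obtain ⟨m, hm⟩ : ∃ m, ∀ v, r v < m := by
    obtain ⟨m, hm⟩ := (Set.finite_range r).bddAbove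
    exact ⟨m + 1, fun v => Nat.lt_succ_of_le (hm ⟨v, rfl⟩)⟩
  by_cases hp : ∃ i, p = Sum.inl (XYZ.x i)
  · obtain ⟨i, rfl⟩ := hp
    obtain ⟨k, hk⟩ : ∃ k, m - r (XYZ.x i) = k := ⟨_, rfl⟩
    induction k using Nat.strong_induction_on generalizing i with
    | _ k ih =>
      by_cases hq : ∃ j, nx (XYZ.x i) false = Sum.inl (XYZ.x j)
      · obtain ⟨j, hj⟩ := hq
        have h1 := hr _ _ _ hj
        have h2 := hm (XYZ.x j)
        obtain ⟨q, hq, hq'⟩ := ih (m - r (XYZ.x j)) (by omega) j rfl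
        exact ⟨q, hq, hq'.head ⟨i, rfl, hj.symm⟩⟩
      · exact ⟨_, fun j hj => hq ⟨j, hj⟩, .single ⟨i, rfl, rfl⟩⟩
  · exact ⟨p, fun i hi => hp ⟨i, hi⟩, .refl⟩

/-- The first vertex that is no `x`-node on the computations with `x = 0` started at `p`. -/
noncomputable def skip (hr : ∃ r, IsRank nx r) (p : XYZ n ⊕ Bool) : XYZ n ⊕ Bool :=
  (exists_skip hr p).choose

variable (hr : ∃ r, IsRank nx r)

theorem skip_ne (p : XYZ n ⊕ Bool) (i : Fin n) : skip hr p ≠ Sum.inl (XYZ.x i) :=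
  (exists_skip hr p).choose_spec.1 i

theorem run_skip (p : XYZ n ⊕ Bool) (ha : XZero a) : Run nx a p (skip hr p) := by
  have h := (exists_skip hr p).choose_spec.2
  change Relation.ReflTransGen _ _ (skip hr p) at h
  generalize skip hr p = s at h ⊢
  induction h with
  | refl => exact .refl
  | tail _ h ih =>
    obtain ⟨i, rfl, rfl⟩ := h
    exact ih.trans (run_next (ha i))

theorem run_skip_of_run (ha : XZero a) (h : Run nx a p q) (hq : ∀ i, q ≠ Sum.inl (XYZ.x i)) :
    Run nx a (skip hr p) q := by
  have h1 := (exists_skip hr p).choose_spec.2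
  change Relation.ReflTransGen _ _ (skip hr p) at h1
  generalize skip hr p = s at h1 ⊢
  induction h1 using Relation.ReflTransGen.head_induction_on with
  | refl => exact h
  | head h1 h2 ih =>
    obtain ⟨i, rfl, rfl⟩ := h1
    rcases run_node_cases h with h | h
    · exact absurd h (hq i)
    · exact ih (ha i ▸ h)

theorem skip_eq_self (hp : ∀ i, p ≠ Sum.inl (XYZ.x i)) : skip hr p = p := by
  rcases Relation.ReflTransGen.cases_head (exists_skip hr p).choose_spec.2 with h | ⟨_, ⟨i, h, _⟩, _⟩
  · exact h.symm
  · exact absurd h (hp i)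

theorem skip_yz (c : Bool) (b : Fin n) : skip hr (Sum.inl (yz c b)) = Sum.inl (yz c b) :=
  skip_eq_self hr fun i h => yz_ne_x c b i (Sum.inl.inj h)

theorem skip_x (i : Fin n) : skip hr (Sum.inl (XYZ.x i)) = skip hr (nx (XYZ.x i) false) := by
  have h0 : XZero (fun _ : XYZ n => false) := fun _ => rfl
  have h1 := run_skip hr (Sum.inl (XYZ.x i)) h0
  have h2 := run_skip_of_run hr h0 (run_node_cases h1 |>.resolve_left (skip_ne hr _ i))
    (skip_ne hr _)
  have h3 := run_skip_of_run hr h0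
    ((run_next (a := fun _ : XYZ n => false) rfl).trans (run_skip hr (nx (XYZ.x i) false) h0))
    (skip_ne hr _)
  obtain ⟨r, hr'⟩ := hr
  rcases hA : skip ⟨r, hr'⟩ (nx (XYZ.x i) false) with u | c <;> rw [hA] at h2 h3
  · rcases hB : skip ⟨r, hr'⟩ (Sum.inl (XYZ.x i)) with w | c <;> rw [hB] at h2 h3
    · rcases hr'.eq_or_lt h2 with h | h
      · rw [h]
      · exact absurd (hr'.le h3) (not_le.2 h)
    · cases run_sink h3
  · exact run_sink h2

theorem eqX_skip (p : XYZ n ⊕ Bool) : EqX nx p (skip hr p) :=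
  fun _ ha => acc_iff_of_run (run_skip hr p ha)

theorem EqX.trans {s : XYZ n ⊕ Bool} (h : EqX nx p q) (h' : EqX nx q s) : EqX nx p s :=
  fun a ha => (h a ha).trans (h' a ha)

theorem eqX_x (i : Fin n) : EqX nx (Sum.inl (XYZ.x i)) (nx (XYZ.x i) false) :=
  fun _ ha => acc_iff_of_run (run_next (ha i))

theorem EqX.st (h : EqX nx p q) (hp : St nx p I) : St nx q I :=
  fun a ha => (h a ha).symm.trans (hp a ha)

theorem St.eqX (hp : St nx p I) (hq : St nx q I) : EqX nx p q :=
  fun a ha => (hp a ha).trans (hq a ha).symm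

/-- If the non-`x` variables all matter at their own nodes, vertices computing the same function
have the same first non-`x` vertex: otherwise each of the two would be reachable from the other. -/
theorem EqX.skip_eq (hself : ∀ c b, Ess nx (Sum.inl (yz c b)) (yz c b)) (h : EqX nx p q) :
    skip hr p = skip hr q := by
  have key : ∀ {p q : XYZ n ⊕ Bool}, EqX nx p q → ∀ w, skip hr p = Sum.inl w →
      ∃ a, XZero a ∧ Run nx a (skip hr q) (Sum.inl w) := by
    intro p q h w hw
    rcases eq_x_or_yz w with ⟨i, rfl⟩ | ⟨c, b, rfl⟩
    · exact absurd hw (skip_ne hr p i)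
    · have h1 := hself c b
      rw [← hw] at h1
      obtain ⟨r, hr'⟩ := hr
      exact ((((eqX_skip _ p).symm.trans h).trans (eqX_skip _ q)).ess h1 |>.run_self hr').1
  rcases hp : skip hr p with w | c <;> rcases hq : skip hr q with w' | c'
  · obtain ⟨a, -, ha⟩ := key h w hp
    obtain ⟨a', -, ha'⟩ := key h.symm w' hq
    rw [hq] at ha
    rw [hp] at ha'
    obtain ⟨r, hr⟩ := hr
    rcases hr.eq_or_lt ha with h | h
    · rw [h]
    · exact absurd (hr.le ha') (not_le.2 h)
  · obtain ⟨a, -, ha⟩ := key h w hp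
    rw [hq] at ha
    cases run_sink ha
  · obtain ⟨a, -, ha⟩ := key h.symm w' hq
    rw [hp] at ha
    cases run_sink ha
  · have := ((eqX_skip hr p).symm.trans h).trans (eqX_skip hr q) (fun _ => false) fun _ => rfl
    rw [hp, hq, acc_sink, acc_sink, ← Bool.eq_iff_iff] at this
    rw [this]

theorem St.ess (h : St nx p I) {b : Fin n} (hb : b ∈ I) (c : Bool) : Ess nx p (yz c b) := by
  classical
  refine ⟨fun u => decide (u = yz c b ∨ u = yz (!c) b), fun u => decide (u = yz (!c) b),
    fun i => ?_, fun i => ?_, fun u hu => by simp [hu], ?_, ?_⟩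
  · simp [(yz_ne_x c b i).symm, (yz_ne_x (!c) b i).symm]
  · simp [(yz_ne_x (!c) b i).symm]
  · rw [h _ (fun i => by simp [(yz_ne_x c b i).symm, (yz_ne_x (!c) b i).symm])]
    exact ⟨b, hb, (yz_and (a := fun u => decide (u = yz c b ∨ u = yz (!c) b)) c b).2 (by simp)⟩
  · rw [h _ (fun i => by simp [(yz_ne_x (!c) b i).symm])]
    rintro ⟨i, -, hi⟩
    have := ((yz_and (a := fun u => decide (u = yz (!c) b)) c i).1 hi).1
    simp only [decide_eq_true_eq, yz_inj] at this
    cases c <;> simp at this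

theorem St.mem_of_ess (h : St nx p I) {c : Bool} {b : Fin n} (he : Ess nx p (yz c b)) :
    b ∈ I := by
  obtain ⟨a, a', ha, ha', hv, h1, h2⟩ := he
  rw [h a ha] at h1
  rw [h a' ha'] at h2
  obtain ⟨i, hi, hyz⟩ := h1
  by_contra hb
  have hib : i ≠ b := by rintro rfl; exact hb hi
  refine h2 ⟨i, hi, (yz_and c i).2 ?_⟩
  have := (yz_and c i).1 hyz
  rwa [hv _ (by simp [yz_inj, hib]), hv _ (by simp [yz_inj, hib])] at this

theorem St.unique {J : Finset (Fin n)} (h : St nx p I) (h' : St nx p J) : I = J := by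
  ext b
  exact ⟨fun hb => h'.mem_of_ess (h.ess hb true), fun hb => h.mem_of_ess (h'.ess hb true)⟩

/-- The function computed at a successor of a node, on assignments with `x = 0`. -/
theorem acc_next (hr : IsRank nx r) (c e : Bool) (b : Fin n) (ha : XZero a) :
    ∃ a', XZero a' ∧ a' (yz c b) = e ∧ (∀ u, u ≠ yz c b → a' u = a u) ∧
      (Acc nx a (nx (yz c b) e) ↔ Acc nx a' (Sum.inl (yz c b))) := by
  classical
  refine ⟨Function.update a (yz c b) e, fun i => ?_, by simp, fun u hu => by simp [hu], ?_⟩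
  · rw [Function.update_of_ne (yz_ne_x c b i).symm]; exact ha i
  · rw [acc_iff_of_run (run_next (Function.update_self _ _ _))]
    refine hr.acc_congr_next e fun u hu => ?_
    rw [Function.update_of_ne]
    rintro rfl
    exact lt_irrefl _ hu

/-- With `x = 0`, the program starts by reading both variables of one pair: a vertex computing
`⋁ i ∈ I, y i ∧ z i` leads to a node for some pair `b ∈ I`, its `1`-edge leads to the other
node of that pair, and both `0`-edges lead to vertices computing the rest of the disjunction. -/
theorem St.pair (hself : ∀ c b, Ess nx (Sum.inl (yz c b)) (yz c b)) (h : St nx p I)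
    (hI : I.Nonempty) : ∃ b ∈ I, ∃ c, skip hr p = Sum.inl (yz c b) ∧
      St nx (nx (yz c b) false) (I.erase b) ∧
      skip hr (nx (yz c b) true) = Sum.inl (yz (!c) b) ∧
      St nx (nx (yz (!c) b) false) (I.erase b) := by
  classical
  obtain ⟨r, hr'⟩ := id hr
  obtain ⟨i₀, hi₀⟩ := hI
  have hs : St nx (skip hr p) I := (eqX_skip hr p).st h
  have node : ∀ {q : XYZ n ⊕ Bool} {v}, Ess nx q v → ∃ c b, skip hr q = Sum.inl (yz c b) := by
    intro q v hv
    rcases hq : skip hr q with w | c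
    · rcases eq_x_or_yz w with ⟨i, rfl⟩ | ⟨c, b, rfl⟩
      · exact absurd hq (skip_ne hr q i)
      · exact ⟨c, b, rfl⟩
    · have := (eqX_skip hr q).ess hv
      rw [hq] at this
      exact (this.not_sink hr').elim
  obtain ⟨c, b, hcb⟩ := node (h.ess hi₀ true)
  rw [hcb] at hs
  have hb : b ∈ I := hs.mem_of_ess (hself c b)
  have h0 : St nx (nx (yz c b) false) (I.erase b) := by
    intro a ha
    obtain ⟨a', ha', he, hne, hiff⟩ := acc_next hr' c false b ha
    rw [hiff, hs a' ha']
    refine ⟨?_, ?_⟩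
    · rintro ⟨i, hi, hyz⟩
      have hib : i ≠ b := by
        rintro rfl
        simpa [he] using ((yz_and c i).1 hyz).1
      refine ⟨i, Finset.mem_erase.2 ⟨hib, hi⟩, (yz_and c i).2 ?_⟩
      have := (yz_and c i).1 hyz
      rwa [hne _ (by simp [yz_inj, hib]), hne _ (by simp [yz_inj, hib])] at this
    · rintro ⟨i, hi, hyz⟩
      have hib := (Finset.mem_erase.1 hi).1
      refine ⟨i, (Finset.mem_erase.1 hi).2, (yz_and c i).2 ?_⟩
      rw [hne _ (by simp [yz_inj, hib]), hne _ (by simp [yz_inj, hib])]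
      exact (yz_and c i).1 hyz
  have h1 : ∀ a, XZero a → (Acc nx a (nx (yz c b) true) ↔ a (yz (!c) b) = true ∨
      ∃ i ∈ I.erase b, a (XYZ.y i) = true ∧ a (XYZ.z i) = true) := by
    intro a ha
    obtain ⟨a', ha', he, hne, hiff⟩ := acc_next hr' c true b ha
    have hb' : a' (yz (!c) b) = a (yz (!c) b) := hne _ (by cases c <;> simp [yz])
    rw [hiff, hs a' ha']
    refine ⟨?_, ?_⟩
    · rintro ⟨i, hi, hyz⟩
      have := (yz_and c i).1 hyz
      by_cases hib : i = b
      · subst hib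
        exact Or.inl (hb' ▸ this.2)
      · refine Or.inr ⟨i, Finset.mem_erase.2 ⟨hib, hi⟩, (yz_and c i).2 ?_⟩
        rwa [hne _ (by simp [yz_inj, hib]), hne _ (by simp [yz_inj, hib])] at this
    · rintro (h | ⟨i, hi, hyz⟩)
      · exact ⟨b, hb, (yz_and c b).2 ⟨he, hb'.trans h⟩⟩
      · have hib := (Finset.mem_erase.1 hi).1
        refine ⟨i, (Finset.mem_erase.1 hi).2, (yz_and c i).2 ?_⟩
        rw [hne _ (by simp [yz_inj, hib]), hne _ (by simp [yz_inj, hib])]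
        exact (yz_and c i).1 hyz
  have hess : Ess nx (nx (yz c b) true) (yz (!c) b) := by
    refine ⟨fun u => decide (u = yz (!c) b), fun _ => false, fun i => ?_, fun _ => rfl,
      fun u hu => by simp [hu], ?_, ?_⟩
    · simp [(yz_ne_x (!c) b i).symm]
    · rw [h1 _ fun i => by simp [(yz_ne_x (!c) b i).symm]]
      simp
    · rw [h1 _ fun _ => rfl]
      simp
  obtain ⟨d, e, hde⟩ := node hess
  have heq := eqX_skip hr (nx (yz c b) true)
  rw [hde] at heq
  -- The next node belongs to the same pair: the nodes of the other pairs in `I` are reachable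
  -- from the `0`-successor, where `yz (!c) b` does not matter.
  have hbe : e = b := by
    by_contra hbe
    have he : Ess nx (nx (yz c b) false) (yz d e) := by
      obtain ⟨a, a', ha, ha', hv, k1, k2⟩ := heq.symm.ess (hself d e)
      rw [h1 a ha] at k1
      rw [h1 a' ha'] at k2
      refine ⟨a, a', ha, ha', hv, (h0 a ha).2 (k1.resolve_left fun k => ?_),
        fun k => k2 (Or.inr ((h0 a' ha').1 k))⟩
      refine k2 (Or.inl ?_)
      rw [← hv _ fun k' => hbe (yz_inj.1 k').2.symm]
      exact k
    obtain ⟨a, ha, hrun⟩ := (he.run_self hr').1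
    exact Finset.notMem_erase b I (h0.mem_of_ess ((heq.ess hess).of_run hr' ha hrun))
  subst hbe
  have hd : d = !c := by
    have h2 : r (yz c e) < r (yz d e) := by
      have := run_skip hr (nx (yz c e) true) (a := fun _ => false) fun _ => rfl
      rw [hde] at this
      exact hr'.run_lt rfl this
    cases c <;> cases d <;> simp_all
  subst hd
  refine ⟨e, hb, c, hcb, h0, hde, ?_⟩
  intro a ha
  obtain ⟨a', ha', he, hne, hiff⟩ := acc_next hr' (!c) false e ha
  rw [hiff, ← heq a' ha', h1 a' ha', he]
  simp only [Bool.false_eq_true, false_or]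
  refine exists_congr fun i => and_congr_right fun hi => ?_
  have hib := (Finset.mem_erase.1 hi).1
  rw [yz_and c, yz_and c, hne _ (by simp [yz_inj, hib]), hne _ (by simp [yz_inj, hib])]

end XZero

/-! ### The order of the pairs, and the `x`-node belonging to a pair -/

section Partner

variable {n : ℕ} (nx : XYZ n → Bool → XYZ n ⊕ Bool) (src : XYZ n ⊕ Bool)

noncomputable instance : DecidableEq (XYZ n) := Classical.decEq _

/-- The assignment that is constant on each of the three groups of variables. -/
def asg (bx bY bz : Bool) : XYZ n → Bool
  | .x _ => bx
  | .y _ => bY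
  | .z _ => bz

/-- The properties of a once-appearance program with source `src` that determine its structure:
with `x = 0` it computes `⋁ i, y i ∧ z i`, and the assignments `(0, 0, 1)` and `(1, 0, 0)` are
sensitive to all variables `x`, `y`, and to all variables `z`, respectively. -/
structure Realizes : Prop where
  rank : ∃ r, IsRank nx r
  st : St nx src Finset.univ
  rejM : ¬ Acc nx (asg false false true) src
  accMx : ∀ i, Acc nx (Function.update (asg false false true) (XYZ.x i) true) src
  accMy : ∀ i, Acc nx (Function.update (asg false false true) (XYZ.y i) true) src
  rejR : ¬ Acc nx (asg true false false) src
  accRz : ∀ i, Acc nx (Function.update (asg true false false) (XYZ.z i) true) src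

variable {nx src} {r : XYZ n → ℕ}

theorem xZero_M : XZero (asg (n := n) false false true) := fun _ => rfl

namespace Realizes

variable (H : Realizes nx src)
include H

theorem runM_x (i : Fin n) : Run nx (asg false false true) src (Sum.inl (XYZ.x i)) :=
  H.rank.choose_spec.run_of_sensitive' (fun u hu => by simp [hu]) (H.accMx i) H.rejM

theorem runM_y (i : Fin n) : Run nx (asg false false true) src (Sum.inl (XYZ.y i)) :=
  H.rank.choose_spec.run_of_sensitive' (fun u hu => by simp [hu]) (H.accMy i) H.rejM

theorem runR_z (i : Fin n) : Run nx (asg true false false) src (Sum.inl (XYZ.z i)) :=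
  H.rank.choose_spec.run_of_sensitive' (fun u hu => by simp [hu]) (H.accRz i) H.rejR

theorem ess_self (c : Bool) (b : Fin n) : Ess nx (Sum.inl (yz c b)) (yz c b) :=
  ((H.st.ess (Finset.mem_univ b) c).run_self H.rank.choose_spec).2

end Realizes

/-- The order in which the pairs `y b`, `z b` are read when `x = 0`: the pair at position `t` has
index `s t`, its first node is `yz (c t) (s t)`, and `I t` is the set of indices of the pairs from
position `t` on. -/
structure PairChain (nx : XYZ n → Bool → XYZ n ⊕ Bool) (src : XYZ n ⊕ Bool) (s : ℕ → Fin n)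
    (c : ℕ → Bool) (I : ℕ → Finset (Fin n)) : Prop extends Realizes nx src where
  st_src : St nx src (I 0)
  skip_eq : ∀ t < n, ∀ p, St nx p (I t) → skip rank p = Sum.inl (yz (c t) (s t))
  st_next : ∀ t < n, ∀ d, St nx (nx (yz d (s t)) false) (I (t + 1))
  skip_next : ∀ t < n, skip rank (nx (yz (c t) (s t)) true) = Sum.inl (yz (!c t) (s t))
  inj : ∀ t < n, ∀ t' < n, s t = s t' → t = t'
  surj : ∀ b, ∃ t < n, s t = b
  set_inj : ∀ t ≤ n, ∀ t' ≤ n, I t = I t' → t = t'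
  set_last : I n = ∅

theorem Realizes.exists_pairChain (H : Realizes nx src) (hn : 0 < n) :
    ∃ s c I, PairChain nx src s c I := by
  classical
  have hstep : ∀ J : Finset (Fin n), ∃ b : Fin n, ∃ c : Bool, J.Nonempty → (∃ p, St nx p J) →
      b ∈ J ∧ (∀ p, St nx p J → skip H.rank p = Sum.inl (yz c b)) ∧
      (∀ d, St nx (nx (yz d b) false) (J.erase b)) ∧
      skip H.rank (nx (yz c b) true) = Sum.inl (yz (!c) b) := by
    intro J
    -- The pair depends only on the set `J`, not on the vertex computing the disjunction.
    by_cases hJ : J.Nonempty ∧ ∃ p, St nx p J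
    · obtain ⟨hJ, p, hp⟩ := hJ
      obtain ⟨b, hb, c, h1, h2, h3, h4⟩ := hp.pair H.rank H.ess_self hJ
      refine ⟨b, c, fun _ _ => ⟨hb, fun q hq => ?_, fun d => ?_, h3⟩⟩
      · rw [← h1]
        exact (hq.eqX hp).skip_eq H.rank H.ess_self
      · by_cases hd : d = c
        · rw [hd]; exact h2
        · rw [Bool.eq_not_of_ne hd]; exact h4
    · exact ⟨⟨0, hn⟩, true, fun h1 h2 => absurd ⟨h1, h2⟩ hJ⟩
  choose β κ hβ using hstep
  set I : ℕ → Finset (Fin n) := fun t => Nat.rec Finset.univ (fun _ J => J.erase (β J)) t with hI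
  have hsucc : ∀ t, I (t + 1) = (I t).erase (β (I t)) := fun t => rfl
  have hst : ∀ t ≤ n, (∃ p, St nx p (I t)) ∧ (I t).card = n - t := by
    intro t
    induction t with
    | zero => exact fun _ => ⟨⟨src, H.st⟩, by simp [hI]⟩
    | succ t ih =>
      intro ht
      obtain ⟨h1, h2⟩ := ih (by omega)
      have hne : (I t).Nonempty := Finset.card_pos.1 (by omega)
      have := hβ (I t) hne h1
      refine ⟨⟨_, this.2.2.1 true⟩, ?_⟩
      rw [hsucc, Finset.card_erase_of_mem this.1]
      omega
  have hgood : ∀ t < n, _ := fun t ht => hβ (I t) (Finset.card_pos.1 (by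
    have := (hst t ht.le).2; omega)) (hst t ht.le).1
  have hanti : ∀ t t', t ≤ t' → I t' ⊆ I t := by
    intro t t' h
    induction h with
    | refl => exact subset_rfl
    | step _ ih => exact (Finset.erase_subset _ _).trans ih
  have hlt : ∀ t t', t < t' → t' < n → β (I t) ≠ β (I t') := by
    intro t t' h ht' he
    have h1 := hanti (t + 1) t' h (hgood t' ht').1
    rw [hsucc, ← he] at h1
    exact Finset.notMem_erase _ _ h1
  have hinj : ∀ t < n, ∀ t' < n, β (I t) = β (I t') → t = t' := by
    intro t ht t' ht' he
    rcases lt_trichotomy t t' with h | h | h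
    · exact absurd he (hlt t t' h ht')
    · exact h
    · exact absurd he.symm (hlt t' t h ht)
  refine ⟨fun t => β (I t), fun t => κ (I t), I, H, H.st, fun t ht => (hgood t ht).2.1,
    fun t ht => (hgood t ht).2.2.1, fun t ht => (hgood t ht).2.2.2, hinj, fun b => ?_,
    fun t ht t' ht' he => ?_, ?_⟩
  · have : Function.Injective fun t : Fin n => β (I t) :=
      fun t t' h => Fin.ext (hinj t t.2 t' t'.2 h)
    obtain ⟨t, ht⟩ := Finite.surjective_of_injective this b
    exact ⟨t, t.2, ht⟩
  · have h1 := (hst t ht).2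
    rw [he, (hst t' ht').2] at h1
    omega
  · have := (hst n le_rfl).2
    exact Finset.card_eq_zero.1 (by omega)

variable {s : ℕ → Fin n} {c : ℕ → Bool} {I : ℕ → Finset (Fin n)}

theorem IsRank.lt_of_skip (hr' : IsRank nx r) (hr : ∃ r, IsRank nx r) {u v : XYZ n} {b : Bool}
    (h : skip hr (nx u b) = Sum.inl v) : r u < r v := by
  have := run_skip hr (nx u b) xZero_M
  rw [h] at this
  exact hr'.run_lt rfl this

theorem IsRank.lt_of_skip_x (hr' : IsRank nx r) (hr : ∃ r, IsRank nx r) {v : XYZ n} {i : Fin n}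
    (h : skip hr (Sum.inl (XYZ.x i)) = Sum.inl v) : r (XYZ.x i) < r v := by
  rw [skip_x] at h
  exact hr'.lt_of_skip hr h

/-- `x a` is the `x`-node belonging to the pair `b`. If the first node of the pair is `z b`
(`c = false`), it is the first `x`-node after `z b` on the computation on `x = 1`, `y = 0` and `z`
the indicator of `b`. If the first node is `y b`, it is the predecessor of `z b` on the
computation on `x = 1`, `y = 0`, `z = 0`. -/
def Partner (nx : XYZ n → Bool → XYZ n ⊕ Bool) (src : XYZ n ⊕ Bool) (c : Bool) (b a : Fin n) :
    Prop :=
  match c with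
  | true => nx (XYZ.x a) true = Sum.inl (XYZ.z b) ∧
      Run nx (asg true false false) src (Sum.inl (XYZ.x a))
  | false => (nx (XYZ.z b) true = Sum.inl (XYZ.x a) ∨
        nx (XYZ.z b) true = Sum.inl (XYZ.y b) ∧ nx (XYZ.y b) false = Sum.inl (XYZ.x a)) ∧
      ¬ Run nx (asg true false false) src (Sum.inl (XYZ.x a))

namespace PairChain

variable (P : PairChain nx src s c I)
include P

theorem skip_last {p : XYZ n ⊕ Bool} (h : St nx p (I n)) : skip P.rank p = Sum.inr false := by
  have h1 := (eqX_skip P.rank p).st h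
  rw [P.set_last] at h1
  rcases hp : skip P.rank p with w | d
  · rw [hp] at h1
    rcases eq_x_or_yz w with ⟨i, rfl⟩ | ⟨d, b, rfl⟩
    · exact absurd hp (skip_ne P.rank p i)
    · exact absurd (h1.mem_of_ess (P.ess_self d b)) (Finset.notMem_empty b)
  · rw [hp] at h1
    have := h1 _ xZero_M
    rw [acc_sink] at this
    cases d
    · rfl
    · simp at this

theorem skip_ne_snd {t t' : ℕ} (ht : t < n) (ht' : t' ≤ n) {p : XYZ n ⊕ Bool}
    (hp : St nx p (I t')) : skip P.rank p ≠ Sum.inl (yz (!c t) (s t)) := by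
  intro h
  rcases ht'.lt_or_eq with h' | rfl
  · rw [P.skip_eq t' h' p hp, Sum.inl.injEq, yz_inj] at h
    have := P.inj _ h' _ ht h.2
    subst this
    simp at h
  · rw [P.skip_last hp] at h
    cases h

theorem skip_st {t : ℕ} {p q : XYZ n ⊕ Bool} (hp : St nx p (I t)) (hq : St nx q (I t)) :
    skip P.rank p = skip P.rank q :=
  (hp.eqX hq).skip_eq P.rank P.ess_self

theorem st_next_y {t : ℕ} (ht : t < n) : St nx (nx (XYZ.y (s t)) false) (I (t + 1)) :=
  P.st_next t ht true

theorem st_next_z {t : ℕ} (ht : t < n) : St nx (nx (XYZ.z (s t)) false) (I (t + 1)) :=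
  P.st_next t ht false

theorem runM_fst {t : ℕ} (ht : t < n) :
    Run nx (asg false false true) src (Sum.inl (yz (c t) (s t))) := by
  cases t with
  | zero =>
    rw [← P.skip_eq 0 ht src P.st_src]
    exact run_skip _ _ xZero_M
  | succ t =>
    rw [← P.skip_eq (t + 1) ht _ (P.st_next t (by omega) true)]
    exact ((P.runM_y (s t)).trans (run_next rfl)).trans (run_skip _ _ xZero_M)

theorem rank_fst_snd (hr : IsRank nx r) {t : ℕ} (ht : t < n) :
    r (yz (c t) (s t)) < r (yz (!c t) (s t)) :=
  hr.lt_of_skip _ (P.skip_next t ht)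

theorem rank_next (hr : IsRank nx r) {t : ℕ} (ht : t + 1 < n) (d : Bool) :
    r (yz d (s t)) < r (yz (c (t + 1)) (s (t + 1))) :=
  hr.lt_of_skip _ (P.skip_eq (t + 1) ht _ (P.st_next t (by omega) d))

/-- The computation on `(1, 0, 0)` enters the node `z b` of a pair whose first node is `y b`
through a `1`-edge of an `x`-node, as the `0`-edges of the other nodes lead to first nodes. -/
theorem exists_partner_true {t : ℕ} (ht : t < n) (hc : c t = true) :
    ∃ a, Partner nx src true (s t) a := by
  have hz : ∀ {t' p}, t' ≤ n → St nx p (I t') → p ≠ Sum.inl (XYZ.z (s t)) := by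
    rintro t' p ht' hp rfl
    have := P.skip_ne_snd ht ht' hp
    rw [hc] at this
    exact this (skip_yz P.rank false (s t))
  rcases Relation.ReflTransGen.cases_tail (P.runR_z (s t)) with h | ⟨q, h, ⟨u, rfl, hu⟩⟩
  · exact absurd h.symm (hz (Nat.zero_le n) P.st_src)
  rcases eq_x_or_yz u with ⟨a, rfl⟩ | ⟨d, b, rfl⟩
  · exact ⟨a, hu.symm, h⟩
  · obtain ⟨t', ht', rfl⟩ := P.surj b
    refine absurd hu.symm (hz (t' := t' + 1) ht' ?_)
    have hd : asg true false false (yz d (s t')) = false := by cases d <;> rfl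
    rw [hd]
    exact P.st_next t' ht' d

/-- The computations on `x = 1`, `y = 0` with `z = 0` and with `z` the indicator of `b` have to
part at the node `z b`; if it is the first node of its pair, they can do so only by an
`x`-node. -/
theorem exists_partner_false {t : ℕ} (ht : t < n) (hc : c t = false) :
    ∃ a, Partner nx src false (s t) a := by
  obtain ⟨r, hr⟩ := P.rank
  set b := s t with hb
  have hskip : skip P.rank (nx (XYZ.z b) true) = Sum.inl (XYZ.y b) := by
    have := P.skip_next t ht
    rw [hc] at this
    exact this
  set R : XYZ n → Bool := asg true false false with hR
  set R' := Function.update R (XYZ.z b) true with hR'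
  have hRz := P.runR_z b
  have hR'z : Run nx R' src (Sum.inl (XYZ.z b)) :=
    hr.run_congr_lt (fun u hu => by
      rw [hR', Function.update_of_ne]; rintro rfl; exact lt_irrefl _ hu) hRz
  have hagree : ∀ u, r (XYZ.z b) < r u → R u = R' u := fun u hu => by
    rw [hR', Function.update_of_ne]; rintro rfl; exact lt_irrefl _ hu
  have hacc : ¬ Acc nx R (nx (XYZ.z b) true) → False := by
    rw [hr.acc_congr_next true hagree, ← acc_iff_of_run (run_next (Function.update_self _ _ _)),
      ← acc_iff_of_run hR'z]
    exact fun h => h (P.accRz b)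
  have hrej : ¬ Acc nx R (nx (XYZ.z b) false) := by
    rw [← acc_node (show R (XYZ.z b) = false from rfl), ← acc_iff_of_run hRz]
    exact P.rejR
  suffices h : ∃ a, nx (XYZ.z b) true = Sum.inl (XYZ.x a) ∨
      nx (XYZ.z b) true = Sum.inl (XYZ.y b) ∧ nx (XYZ.y b) false = Sum.inl (XYZ.x a) by
    obtain ⟨a, ha⟩ := h
    refine ⟨a, ha, fun hrun => hacc fun h => P.rejR ?_⟩
    rw [acc_iff_of_run hrun]
    rcases ha with ha | ⟨ha, ha'⟩
    · rwa [ha] at h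
    · rw [ha] at h
      rw [← ha', ← acc_node (show R (XYZ.y b) = false from rfl)]
      exact h
  by_contra hno
  simp only [not_exists, not_or, not_and] at hno
  have h1 : nx (XYZ.z b) true = Sum.inl (XYZ.y b) := by
    rw [← hskip, skip_eq_self _ fun i => (hno i).1]
  set q := nx (XYZ.y b) false with hq
  have hqx : ∀ i, q ≠ Sum.inl (XYZ.x i) := fun i => (hno i).2 h1
  have hse : skip P.rank (nx (XYZ.z b) false) = q := by
    rw [P.skip_st (P.st_next_z ht) (P.st_next_y ht)]
    exact skip_eq_self _ hqx
  by_cases he : ∃ i, nx (XYZ.z b) false = Sum.inl (XYZ.x i)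
  · -- An `x`-node entered from `z b` lies on the computation on `(0, 0, 1)`, which goes from `z b`
    -- through `y b` to `q` without visiting an `x`-node, while this node leads to `q`.
    obtain ⟨i, hi⟩ := he
    have hMz : Run nx (asg false false true) src (Sum.inl (XYZ.z b)) := by
      have := P.runM_fst ht
      rw [hc] at this
      exact this
    have hzx := hr _ _ _ hi
    rcases run_total hMz (P.runM_x i) with h | h
    · have h2 := run_next_of_ne h (b := true) rfl (by simp)
      rw [h1] at h2
      have h3 := run_next_of_ne h2 (b := false) rfl (by simp)
      rw [← hq] at h3
      rw [hi] at hse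
      have h4 := run_skip P.rank (Sum.inl (XYZ.x i)) (xZero_M (n := n))
      rw [hse] at h4
      rcases hqq : q with w | d <;> rw [hqq] at h3 h4 hqx
      · rcases hr.eq_or_lt h3 with h | h
        · exact hqx i (by rw [h])
        · exact absurd (hr.le h4) (not_le.2 h)
      · cases run_sink h3
    · exact absurd (hr.le h) (not_le.2 hzx)
  · rw [skip_eq_self _ fun i hi => he ⟨i, hi⟩] at hse
    refine hacc fun h => hrej ?_
    rw [hse, hq, ← acc_node (show R (XYZ.y b) = false from rfl)]
    rwa [h1] at h

theorem exists_partner {t : ℕ} (ht : t < n) : ∃ a, Partner nx src (c t) (s t) a := by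
  cases hc : c t
  · exact P.exists_partner_false ht hc
  · exact P.exists_partner_true ht hc

/-- An `x`-node belongs to at most one pair. -/
theorem partner_inj {t t' : ℕ} (ht : t < n) (ht' : t' < n) {a : Fin n}
    (h : Partner nx src (c t) (s t) a) (h' : Partner nx src (c t') (s t') a) : t = t' := by
  have aux : ∀ {t t' : ℕ}, t < n → t' < n → c t = false → c t' = false →
      nx (XYZ.z (s t)) true = Sum.inl (XYZ.x a) → nx (XYZ.y (s t')) false = Sum.inl (XYZ.x a) →
      False := by
    intro t t' ht ht' hc hc' h h'
    have h1 := P.skip_next t ht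
    have h2 := P.st_next_y ht'
    have h3 := P.skip_ne_snd ht ht' h2
    rw [hc] at h1 h3
    change skip P.rank (nx (XYZ.z (s t)) true) = _ at h1
    rw [h] at h1
    rw [h'] at h3
    exact h3 h1
  cases hc : c t <;> cases hc' : c t' <;> rw [hc] at h <;> rw [hc'] at h'
  · rcases h.1 with h1 | ⟨-, h1⟩ <;> rcases h'.1 with h2 | ⟨-, h2⟩
    · have h3 := P.skip_next t ht
      have h4 := P.skip_next t' ht'
      rw [hc] at h3
      rw [hc'] at h4
      change skip P.rank (nx (XYZ.z (s t)) true) = _ at h3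
      change skip P.rank (nx (XYZ.z (s t')) true) = _ at h4
      rw [h1] at h3
      rw [h2, h3, Sum.inl.injEq, yz_inj] at h4
      exact P.inj _ ht _ ht' h4.2
    · exact (aux ht ht' hc hc' h1 h2).elim
    · exact (aux ht' ht hc' hc h2 h1).elim
    · have h3 := P.st_next_y ht
      have h4 := P.st_next_y ht'
      rw [h1] at h3
      rw [h2] at h4
      have := P.set_inj (t + 1) ht (t' + 1) ht' (h3.unique h4)
      omega
  · exact absurd h'.2 h.2
  · exact absurd h.2 h'.2
  · have := h.1.symm.trans h'.1
    rw [Sum.inl.injEq, XYZ.z.injEq] at this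
    exact P.inj _ ht _ ht' this

end PairChain

end Partner

/-! ### The triplets are read one after the other -/

section Triple

variable {n : ℕ} {nx : XYZ n → Bool → XYZ n ⊕ Bool} {src : XYZ n ⊕ Bool} {r : XYZ n → ℕ}
  {s : ℕ → Fin n} {c : ℕ → Bool} {I : ℕ → Finset (Fin n)} {A : ℕ → Fin n}

/-- A chain of pairs together with the `x`-nodes belonging to them. -/
structure TripleChain (nx : XYZ n → Bool → XYZ n ⊕ Bool) (src : XYZ n ⊕ Bool) (s : ℕ → Fin n)
    (c : ℕ → Bool) (I : ℕ → Finset (Fin n)) (A : ℕ → Fin n) : Prop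
    extends PairChain nx src s c I where
  partner : ∀ t < n, Partner nx src (c t) (s t) (A t)

theorem Realizes.exists_tripleChain (H : Realizes nx src) (hn : 0 < n) :
    ∃ s c I A, TripleChain nx src s c I A := by
  obtain ⟨s, c, I, P⟩ := H.exists_pairChain hn
  have : ∀ t, ∃ a, t < n → Partner nx src (c t) (s t) a := fun t => by
    by_cases ht : t < n
    · obtain ⟨a, ha⟩ := P.exists_partner ht
      exact ⟨a, fun _ => ha⟩
    · exact ⟨⟨0, hn⟩, fun h => absurd h ht⟩
  choose A hA using this
  exact ⟨s, c, I, A, P, hA⟩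

/-- The triplet of variables at position `t`. -/
def triple (s A : ℕ → Fin n) (t : ℕ) : Set (XYZ n) := {XYZ.x (A t), XYZ.y (s t), XYZ.z (s t)}

theorem mem_triple {t : ℕ} {u : XYZ n} :
    u ∈ triple s A t ↔ u = XYZ.x (A t) ∨ ∃ d, u = yz d (s t) := by
  simp [triple, yz, or_comm]

theorem x_mem_triple (t : ℕ) : XYZ.x (A t) ∈ triple s A t := mem_triple.2 (Or.inl rfl)

theorem yz_mem_triple (d : Bool) (t : ℕ) : yz d (s t) ∈ triple s A t :=
  mem_triple.2 (Or.inr ⟨d, rfl⟩)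

/-- The vertex that is entered after the triplets before position `t` have evaluated to `0`. -/
def entry (nx : XYZ n → Bool → XYZ n ⊕ Bool) (src : XYZ n ⊕ Bool) (s : ℕ → Fin n) :
    ℕ → XYZ n ⊕ Bool
  | 0 => src
  | t + 1 => nx (XYZ.z (s t)) false

namespace TripleChain

variable (T : TripleChain nx src s c I A)
include T

theorem A_inj {t t' : ℕ} (ht : t < n) (ht' : t' < n) (h : A t = A t') : t = t' :=
  T.partner_inj ht ht' (T.partner t ht) (h ▸ T.partner t' ht')

theorem A_surj (a : Fin n) : ∃ t < n, A t = a := by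
  have : Function.Injective fun t : Fin n => A t := fun t t' h => Fin.ext (T.A_inj t.2 t'.2 h)
  obtain ⟨t, ht⟩ := Finite.surjective_of_injective this a
  exact ⟨t, t.2, ht⟩

theorem rank_fst_le (hr : IsRank nx r) {t : ℕ} (ht : t < n) (d : Bool) :
    r (yz (c t) (s t)) ≤ r (yz d (s t)) := by
  by_cases hd : d = c t
  · rw [hd]
  · rw [Bool.eq_not_of_ne hd]
    exact (T.rank_fst_snd hr ht).le

theorem rank_y_lt_z (hr : IsRank nx r) {t : ℕ} (ht : t < n) (hc : c t = true) :
    r (XYZ.y (s t)) < r (XYZ.z (s t)) := by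
  have := T.rank_fst_snd hr ht
  rwa [hc] at this

theorem partner_true {t : ℕ} (ht : t < n) (hc : c t = true) :
    nx (XYZ.x (A t)) true = Sum.inl (XYZ.z (s t)) ∧
      Run nx (asg true false false) src (Sum.inl (XYZ.x (A t))) := by
  have := T.partner t ht
  rwa [hc] at this

theorem partner_false {t : ℕ} (ht : t < n) (hc : c t = false) :
    (nx (XYZ.z (s t)) true = Sum.inl (XYZ.x (A t)) ∨
      nx (XYZ.z (s t)) true = Sum.inl (XYZ.y (s t)) ∧
        nx (XYZ.y (s t)) false = Sum.inl (XYZ.x (A t))) ∧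
      ¬ Run nx (asg true false false) src (Sum.inl (XYZ.x (A t))) := by
  have := T.partner t ht
  rwa [hc] at this

theorem rank_z_lt_x (hr : IsRank nx r) {t : ℕ} (ht : t < n) (hc : c t = false) :
    r (XYZ.z (s t)) < r (XYZ.x (A t)) := by
  rcases (T.partner_false ht hc).1 with h | ⟨h, h'⟩
  · exact hr _ _ _ h
  · exact (hr _ _ _ h).trans (hr _ _ _ h')

theorem skip_x_of_false {t : ℕ} (ht : t < n) (hc : c t = false)
    (h : nx (XYZ.z (s t)) true = Sum.inl (XYZ.x (A t))) :
    skip T.rank (Sum.inl (XYZ.x (A t))) = Sum.inl (XYZ.y (s t)) := by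
  have := T.skip_next t ht
  rw [hc] at this
  rw [← h]
  exact this

theorem rank_lt_fst (hr : IsRank nx r) {t : ℕ} (ht : t + 1 < n) {u : XYZ n}
    (hu : u ∈ triple s A t) : r u < r (yz (c (t + 1)) (s (t + 1))) := by
  have ht' : t < n := by omega
  rcases mem_triple.1 hu with rfl | ⟨d, rfl⟩
  · cases hc : c t
    · rcases (T.partner_false ht' hc).1 with h | ⟨-, h⟩
      · exact (hr.lt_of_skip_x _ (T.skip_x_of_false ht' hc h)).trans (T.rank_next hr ht true)
      · have := T.skip_eq (t + 1) ht _ (T.st_next_y ht')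
        rw [h] at this
        exact hr.lt_of_skip_x _ this
    · exact (hr _ _ _ (T.partner_true ht' hc).1).trans (T.rank_next hr ht false)
  · exact T.rank_next hr ht d

/-- All nodes of a triplet come before the `x`-node of the following one. The case in question is
that of an `x`-node whose `1`-edge leads to `z`; it lies on the computation on `(1, 0, 0)`, which
has to visit the preceding `z` before. -/
theorem rank_lt_x (hr : IsRank nx r) {t : ℕ} (ht : t + 1 < n) {u : XYZ n}
    (hu : u ∈ triple s A t) : r u < r (XYZ.x (A (t + 1))) := by
  have ht' : t < n := by omega
  cases hc' : c (t + 1)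
  · have h1 := T.rank_lt_fst hr ht hu
    rw [hc'] at h1
    exact h1.trans (T.rank_z_lt_x hr ht hc')
  obtain ⟨hxz, hxR⟩ := T.partner_true ht hc'
  have hyz := T.rank_y_lt_z hr ht hc'
  have hz : ∀ d, r (yz d (s t)) < r (XYZ.y (s (t + 1))) := fun d => by
    have := T.rank_next hr ht d
    rwa [hc'] at this
  have hrunz : Run nx (asg true false false) (Sum.inl (XYZ.z (s t)))
      (Sum.inl (XYZ.x (A (t + 1)))) := by
    rcases run_total (T.runR_z (s t)) hxR with h | h
    · exact h
    · have h1 := run_next_of_ne h (b := true) rfl (by simp)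
      rw [hxz] at h1
      have h2 := hr.le h1
      have h3 := hz false
      change r (XYZ.z (s t)) < _ at h3
      omega
  have hzx : r (XYZ.z (s t)) < r (XYZ.x (A (t + 1))) :=
    (hr.eq_or_lt hrunz).resolve_left (by simp)
  have hyx : r (XYZ.y (s t)) < r (XYZ.x (A (t + 1))) := by
    cases hc : c t
    · rcases run_total (T.runM_y (s t)) (T.runM_x (A (t + 1))) with h | h
      · exact (hr.eq_or_lt h).resolve_left (by simp)
      · -- If `x (A (t + 1))` came before `y (s t)`, then so would the `0`-successor of `z (s t)`,
        -- although this vertex is, or leads to, the first node of the following pair.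
        exfalso
        have h1 := hr.le h
        have h2 := hz true
        change r (XYZ.y (s t)) < _ at h2
        have h3 := run_next_of_ne hrunz (b := false) rfl (by simp)
        have h4 := T.skip_eq (t + 1) ht _ (T.st_next_z ht')
        rw [hc'] at h4
        change _ = Sum.inl (XYZ.y (s (t + 1))) at h4
        by_cases hi : ∃ i, nx (XYZ.z (s t)) false = Sum.inl (XYZ.x i)
        · obtain ⟨i, hi⟩ := hi
          rw [hi] at h3 h4
          have h5 := hr.le h3
          rcases run_total (T.runM_x i) (T.runM_y (s t)) with h6 | h6
          · have h7 := run_skip_of_run T.rank xZero_M h6 (by simp)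
            rw [h4] at h7
            exact absurd (hr.le h7) (not_le.2 h2)
          · have h7 := (hr.eq_or_lt h6).resolve_left (by simp)
            omega
        · rw [skip_eq_self _ fun i h => hi ⟨i, h⟩] at h4
          rw [h4] at h3
          have := hr.le h3
          omega
    · exact (T.rank_y_lt_z hr ht' hc).trans hzx
  rcases mem_triple.1 hu with rfl | ⟨d, rfl⟩
  · cases hc : c t
    · rcases (T.partner_false ht' hc).1 with h | ⟨-, h⟩
      · exact (hr.lt_of_skip_x _ (T.skip_x_of_false ht' hc h)).trans hyx
      · rcases run_total (T.runM_y (s t)) (T.runM_x (A (t + 1))) with h1 | h1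
        · have h2 := run_next_of_ne h1 (b := false) rfl (by simp)
          rw [h] at h2
          rcases hr.eq_or_lt h2 with h3 | h3
          · have := T.A_inj ht' ht (XYZ.x.inj h3)
            omega
          · exact h3
        · exact absurd (hr.le h1) (not_le.2 hyx)
    · exact (hr _ _ _ (T.partner_true ht' hc).1).trans hzx
  · cases d
    · exact hzx
    · exact hyx

theorem rank_lt_succ (hr : IsRank nx r) {t : ℕ} (ht : t + 1 < n) {u v : XYZ n}
    (hu : u ∈ triple s A t) (hv : v ∈ triple s A (t + 1)) : r u < r v := by
  rcases mem_triple.1 hv with rfl | ⟨d, rfl⟩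
  · exact T.rank_lt_x hr ht hu
  · exact (T.rank_lt_fst hr ht hu).trans_le (T.rank_fst_le hr ht d)

/-- The nodes of a triplet come before those of all later triplets, in every topological
order. -/
theorem rank_lt (hr : IsRank nx r) {t t' : ℕ} (h : t < t') (ht' : t' < n) {u v : XYZ n}
    (hu : u ∈ triple s A t) (hv : v ∈ triple s A t') : r u < r v := by
  induction h generalizing v with
  | refl => exact T.rank_lt_succ hr ht' hu hv
  | step _ ih =>
    exact (ih (by omega) (x_mem_triple _)).trans (T.rank_lt_succ hr ht' (x_mem_triple _) hv)

/-! ### Assignments with `y = 0` on which all triplets evaluate to `0` -/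

theorem entry_st {t : ℕ} (ht : t ≤ n) : St nx (entry nx src s t) (I t) := by
  cases t with
  | zero => exact T.st_src
  | succ t => exact T.st_next_z ht

theorem entry_runR (t : ℕ) : Run nx (asg true false false) src (entry nx src s t) := by
  cases t with
  | zero => exact .refl
  | succ t => exact (T.runR_z (s t)).trans (run_next rfl)

/-- The entry of a triplet is an `x`-node only if it is the `x`-node of this triplet and `y` comes
before `z` in it: the entries lie on the computation on `(1, 0, 0)`, which avoids the other
`x`-nodes. -/
theorem entry_eq_x (hr : IsRank nx r) {t : ℕ} (ht : t ≤ n) {i : Fin n}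
    (h : entry nx src s t = Sum.inl (XYZ.x i)) : t < n ∧ c t = true ∧ i = A t := by
  obtain ⟨t', ht', rfl⟩ := T.A_surj i
  have hc : c t' = true := by
    by_contra hc
    refine (T.partner_false ht' (Bool.eq_false_of_not_eq_true hc)).2 ?_
    rw [← h]
    exact T.entry_runR t
  have hxz := hr _ _ _ (T.partner_true ht' hc).1
  rcases lt_trichotomy t' t with h1 | rfl | h1
  · cases t with
    | zero => omega
    | succ t =>
      have h2 := hr _ _ _ h
      have h3 : r (XYZ.z (s t')) ≤ r (XYZ.z (s t)) := by
        rcases Nat.lt_succ_iff_lt_or_eq.1 h1 with h4 | rfl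
        · exact (T.rank_lt hr h4 (by omega) (yz_mem_triple false t')
            (yz_mem_triple false t)).le
        · exact le_rfl
      omega
  · exact ⟨ht', hc, rfl⟩
  · have h2 := T.skip_eq t (by omega) _ (T.entry_st ht)
    rw [h] at h2
    have h3 := hr.lt_of_skip_x _ h2
    have h4 := T.rank_lt hr h1 ht' (yz_mem_triple (A := A) (c t) t) (x_mem_triple t')
    omega

/-- The last node of the triplet at position `t` and the node `z` of this triplet have the same
`0`-successor. -/
theorem next_eq_entry (hr : IsRank nx r) {t : ℕ} (ht : t < n) {w : XYZ n}
    (hw : w ∈ triple s A t) (hM : Run nx (asg false false true) src (Sum.inl w))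
    (hw0 : asg false false true w = false) (hst : St nx (nx w false) (I (t + 1)))
    (hx : r (XYZ.x (A t)) ≤ r w) : nx w false = entry nx src s (t + 1) := by
  have hskip := T.skip_st hst (T.entry_st ht)
  by_cases hi : ∃ i, nx w false = Sum.inl (XYZ.x i)
  · obtain ⟨i, hi⟩ := hi
    have h1 := hr _ _ _ hi
    obtain ⟨t', ht', rfl⟩ := T.A_surj i
    have htt : t < t' := by
      by_contra h
      rcases (not_lt.1 h).lt_or_eq with h | rfl
      · have := T.rank_lt hr h ht (x_mem_triple (s := s) t') (x_mem_triple t)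
        omega
      · omega
    have h2 := T.skip_eq (t + 1) (by omega) _ hst
    have h2' := h2
    rw [hi] at h2
    have h3 := hr.lt_of_skip_x _ h2
    obtain rfl : t' = t + 1 := by
      by_contra h
      have := T.rank_lt hr (t := t + 1) (t' := t') (by omega) ht'
        (yz_mem_triple (A := A) (c (t + 1)) (t + 1)) (x_mem_triple t')
      omega
    cases hc : c (t + 1) <;> rw [hc] at h3 h2'
    · exact absurd (T.rank_z_lt_x hr ht' hc) (not_lt.2 h3.le)
    · by_cases hj : ∃ j, entry nx src s (t + 1) = Sum.inl (XYZ.x j)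
      · obtain ⟨j, hj⟩ := hj
        rw [hi, hj, (T.entry_eq_x hr ht hj).2.2]
      · rw [hskip, skip_eq_self _ fun i h => hj ⟨i, h⟩] at h2'
        have h4 := T.entry_runR (t + 1)
        rw [h2'] at h4
        obtain ⟨h5, h6⟩ := T.partner_true ht' hc
        rcases run_total h4 h6 with h | h
        · exact absurd (hr.le h) (not_le.2 h3)
        · have h7 := run_next_of_ne h (b := true) rfl (yz_ne_x _ _ _).symm
          rw [h5] at h7
          exact absurd (hr.le h7) (not_le.2 (T.rank_y_lt_z hr ht' hc))
  · rw [skip_eq_self _ fun i h => hi ⟨i, h⟩] at hskip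
    by_cases hj : ∃ j, entry nx src s (t + 1) = Sum.inl (XYZ.x j)
    · obtain ⟨j, hj⟩ := hj
      obtain ⟨ht', hc, rfl⟩ := T.entry_eq_x hr ht hj
      have h1 := T.skip_eq (t + 1) ht' _ (T.entry_st ht)
      rw [hj] at h1 hskip
      have h2 := hr.lt_of_skip_x _ h1
      have h3 := T.rank_lt_succ hr ht' hw (x_mem_triple (t + 1))
      rcases run_total hM (T.runM_x (A (t + 1))) with h | h
      · have h4 := run_next_of_ne h hw0 (by rintro rfl; exact lt_irrefl _ h3)
        rw [hskip, h1] at h4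
        exact absurd (hr.le h4) (not_le.2 h2)
      · exact absurd (hr.le h) (not_le.2 h3)
    · rw [hskip, skip_eq_self _ fun i h => hj ⟨i, h⟩]

/-- No further `x`-node lies between the `x`-node of a triplet and its node `y`. -/
theorem next_x_eq_y (hr : IsRank nx r) {t : ℕ} (ht : t < n)
    (h : skip T.rank (nx (XYZ.x (A t)) false) = Sum.inl (XYZ.y (s t))) :
    nx (XYZ.x (A t)) false = Sum.inl (XYZ.y (s t)) := by
  rw [← h]
  refine (skip_eq_self _ fun i hi => ?_).symm
  have h1 := hr _ _ _ hi
  rw [hi] at h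
  have h2 := hr.lt_of_skip_x _ h
  obtain ⟨t', ht', rfl⟩ := T.A_surj i
  rcases lt_trichotomy t' t with h3 | rfl | h3
  · have := T.rank_lt hr h3 ht (x_mem_triple (s := s) t') (x_mem_triple t)
    omega
  · omega
  · have := T.rank_lt hr h3 ht' (yz_mem_triple (A := A) true t) (x_mem_triple t')
    change r (XYZ.y (s t)) < _ at this
    omega

variable {a : XYZ n → Bool}

/-- If `y = 0` and `z b ∧ x a` is `0` for the triplet `x a`, `y b`, `z b` at position `t`, then the
computation passes from its entry to the next one. The order of the three nodes is one of
`z, x, y`, `z, y, x`, `x, y, z` and `y, x, z`. -/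
theorem acc_entry_succ (hr : IsRank nx r) {t : ℕ} (ht : t < n)
    (hy : ∀ i, a (XYZ.y i) = false) (hzx : a (XYZ.z (s t)) = true → a (XYZ.x (A t)) = false) :
    Acc nx a (entry nx src s t) ↔ Acc nx a (entry nx src s (t + 1)) := by
  have hez : a (XYZ.z (s t)) = false →
      (Acc nx a (Sum.inl (XYZ.z (s t))) ↔ Acc nx a (entry nx src s (t + 1))) := fun h => acc_node h
  have hyy : r (XYZ.x (A t)) ≤ r (XYZ.y (s t)) →
      (Acc nx a (Sum.inl (XYZ.y (s t))) ↔ Acc nx a (entry nx src s (t + 1))) := fun h => by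
    rw [acc_node (hy _), ← T.next_eq_entry hr ht (yz_mem_triple true t) (T.runM_y _) rfl
      (T.st_next_y ht) h]
    rfl
  have hxx : a (XYZ.x (A t)) = false → St nx (Sum.inl (XYZ.x (A t))) (I (t + 1)) →
      (Acc nx a (Sum.inl (XYZ.x (A t))) ↔ Acc nx a (entry nx src s (t + 1))) := fun h hst => by
    rw [acc_node h, T.next_eq_entry hr ht (x_mem_triple t) (T.runM_x _) rfl
      ((eqX_x _).st hst) le_rfl]
  have hfst := T.skip_eq t ht _ (T.entry_st ht.le)
  cases hc : c t
  · have he : entry nx src s t = Sum.inl (XYZ.z (s t)) := by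
      rw [hc] at hfst
      refine (skip_eq_self T.rank fun i hi => ?_).symm.trans hfst
      have := (T.entry_eq_x hr ht.le hi).2.1
      simp [hc] at this
    rw [he]
    cases hz : a (XYZ.z (s t))
    · exact hez hz
    · rw [acc_node hz]
      rcases (T.partner_false ht hc).1 with h | ⟨h, h'⟩
      · have h1 := T.skip_x_of_false ht hc h
        have h2 := hr.lt_of_skip_x _ h1
        rw [skip_x] at h1
        rw [h, acc_node (hzx hz), T.next_x_eq_y hr ht h1]
        exact hyy h2.le
      · rw [h, acc_node (hy _), h']
        exact hxx (hzx hz) (h' ▸ T.st_next_y ht)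
  · obtain ⟨hxz, hxR⟩ := T.partner_true ht hc
    have hyz := T.rank_y_lt_z hr ht hc
    rw [hc] at hfst
    have hx1 : a (XYZ.x (A t)) = true →
        (Acc nx a (Sum.inl (XYZ.x (A t))) ↔ Acc nx a (entry nx src s (t + 1))) := fun h => by
      rw [acc_node h, hxz]
      exact hez (by by_contra h'; simp [h] at hzx; simp [hzx] at h')
    by_cases hi : ∃ i, entry nx src s t = Sum.inl (XYZ.x i)
    · obtain ⟨i, hi⟩ := hi
      obtain ⟨-, -, rfl⟩ := T.entry_eq_x hr ht.le hi
      rw [hi]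
      cases hx : a (XYZ.x (A t))
      · rw [hi] at hfst
        have h2 := hr.lt_of_skip_x _ hfst
        rw [skip_x] at hfst
        rw [acc_node hx, T.next_x_eq_y hr ht hfst]
        exact hyy h2.le
      · exact hx1 hx
    · have he : entry nx src s t = Sum.inl (XYZ.y (s t)) := by
        rw [← skip_eq_self T.rank fun i h => hi ⟨i, h⟩]
        exact hfst
      have hyx : r (XYZ.y (s t)) < r (XYZ.x (A t)) := by
        have h1 := T.entry_runR t
        rw [he] at h1
        rcases run_total h1 hxR with h | h
        · exact (hr.eq_or_lt h).resolve_left (by simp)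
        · have h2 := run_next_of_ne h (b := true) rfl (by simp)
          rw [hxz] at h2
          exact absurd (hr.le h2) (not_le.2 hyz)
      have hrun : Run nx (asg false false true) (nx (XYZ.y (s t)) false)
          (Sum.inl (XYZ.x (A t))) := by
        rcases run_total (T.runM_y (s t)) (T.runM_x (A t)) with h | h
        · exact run_next_of_ne h rfl (by simp)
        · exact absurd (hr.le h) (not_le.2 hyx)
      have hq : nx (XYZ.y (s t)) false = Sum.inl (XYZ.x (A t)) := by
        by_cases hj : ∃ j, nx (XYZ.y (s t)) false = Sum.inl (XYZ.x j)
        · obtain ⟨j, hj⟩ := hj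
          rw [hj] at hrun
          have h1 := hr.le hrun
          have h2 := hr _ _ _ hj
          obtain ⟨t', ht', rfl⟩ := T.A_surj j
          rcases lt_trichotomy t' t with h3 | rfl | h3
          · have := T.rank_lt hr h3 ht (x_mem_triple (s := s) t') (yz_mem_triple (A := A) true t)
            change _ < r (XYZ.y (s t)) at this
            omega
          · exact hj
          · have := T.rank_lt hr h3 ht' (x_mem_triple (s := s) t) (x_mem_triple t')
            omega
        · have h1 := T.st_next_y ht
          rw [← skip_eq_self T.rank fun j h => hj ⟨j, h⟩] at hrun
          rcases (show t + 1 ≤ n from ht).lt_or_eq with h2 | h2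
          · rw [T.skip_eq _ h2 _ h1] at hrun
            have h3 := hr.le hrun
            have h4 := T.rank_lt_fst hr h2 (x_mem_triple (s := s) (A := A) t)
            omega
          · rw [h2] at h1
            rw [T.skip_last h1] at hrun
            cases run_sink hrun
      rw [he, acc_node (hy _), hq]
      cases hx : a (XYZ.x (A t))
      · exact hxx hx (hq ▸ T.st_next_y ht)
      · exact hx1 hx

/-- On assignments with `y = 0` the program rejects if the conjunction of `z b` and the `x`-node
belonging to `b` is `0` for all `b`. -/
theorem not_acc (hy : ∀ i, a (XYZ.y i) = false)
    (hzx : ∀ t < n, a (XYZ.z (s t)) = true → a (XYZ.x (A t)) = false) : ¬ Acc nx a src := by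
  obtain ⟨r, hr⟩ := T.rank
  have h : ∀ t ≤ n, (Acc nx a src ↔ Acc nx a (entry nx src s t)) := by
    intro t
    induction t with
    | zero => exact fun _ => Iff.rfl
    | succ t ih => exact fun ht =>
        (ih (by omega)).trans (T.acc_entry_succ hr (by omega) hy (hzx t (by omega)))
  rw [h n le_rfl, ← skip_eq_self T.rank fun i hi => lt_irrefl _ (T.entry_eq_x hr le_rfl hi).1,
    T.skip_last (T.entry_st le_rfl), acc_sink]
  exact Bool.false_ne_true

end TripleChain

end Triple

/-! ### Values of `γ_G` -/

section Gamma

variable {n : ℕ} {G : SimpleGraph (Fin n × Fin n)} {x y z : Fin n → Bool}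

theorem gammaVec_x_zero (hx : ∀ i, x i = false) :
    gammaVec G x y z = some (decide (∃ i, y i = true ∧ z i = true)) := by
  rw [gammaVec, if_pos hx]

theorem gammaVec_x_one (hn : 0 < n) (hx : ∀ i, x i = true) :
    gammaVec G x y z = some (decide (∃ i, z i = true)) := by
  rw [gammaVec, if_neg fun h => by simpa [hx] using h ⟨0, hn⟩, if_pos hx]

theorem gammaVec_z_one (hn : 0 < n) (hz : ∀ i, z i = true) :
    gammaVec G x y z = some (decide (∃ i, x i = true ∨ y i = true)) := by
  rw [gammaVec]
  split_ifs with h1 h2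
  · simp [h1, hz]
  · have : Nonempty (Fin n) := ⟨⟨0, hn⟩⟩
    simp [h2, hz]
  · rfl

open Classical in
theorem gammaVec_half (hn : Even n) (hn0 : 0 < n) (hz : ∀ i, z i = true ↔ InFirstHalf i)
    (hy : ∀ i, y i = false) :
    gammaVec G x y z = some (decide (∃ i, InFirstHalf i ∧ x i = true)) := by
  obtain ⟨m, rfl⟩ := hn
  have h0 : InFirstHalf (⟨0, hn0⟩ : Fin (m + m)) := by simp only [InFirstHalf]; omega
  have hm : ¬ InFirstHalf (⟨m, by omega⟩ : Fin (m + m)) := by simp only [InFirstHalf]; omega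
  rw [gammaVec]
  split_ifs with h1 h2 h3 h4 h5
  · simp [h1, hy]
  · simp [h2, hz]
  · exact absurd ((hz _).1 (h3 _)) hm
  · exact absurd ((hz _).2 h0) (by simp [h4])
  · rfl
  · exact absurd ⟨hz, hy⟩ h5
  · exact absurd ⟨hz, hy⟩ h5
  · exact absurd ⟨hz, hy⟩ h5

theorem gammaVec_edge (hn2 : 2 < n) (h : EdgeClause G x y z) : gammaVec G x y z = some true := by
  have hne : ∀ i j : Fin n, ∃ k, k ≠ i ∧ k ≠ j := by
    intro i j
    by_contra! hk
    have : (Finset.univ : Finset (Fin n)) ⊆ {i, j} := fun k _ => by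
      by_cases h : k = i
      · simp [h]
      · simp [hk k h]
    have := (Finset.card_le_card this).trans Finset.card_le_two
    rw [Finset.card_fin] at this
    omega
  have hE := h
  obtain ⟨j, k, j', k', hJ, hJ', -, hx, hy, hz⟩ := h
  rw [gammaVec]
  split_ifs with h1 h2 h3 h4 h5 h6
  · obtain ⟨i, hi⟩ := hne k k'
    exact absurd ((hx i).1 (h1 i)) (by simp [hi])
  · exact absurd ((hx k).2 (Or.inl rfl)) (by simp [h2])
  · obtain ⟨i, hi⟩ := hne j j'
    exact absurd ((hz i).1 (h3 i)) (by simp [hi])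
  · exact absurd ((hz j).2 (Or.inl rfl)) (by simp [h4])
  · exact absurd ((h5.1 j').1 ((hz j').2 (Or.inr rfl))) hJ'.1
  · exact absurd hJ.1 ((h6.1 j).1 ((hz j).2 (Or.inl rfl)))
  · rfl

end Gamma

/-! ### From a once-appearance program to the permutation -/

section Structure

variable {n : ℕ} {G : SimpleGraph (Fin n × Fin n)} {B : BranchingProgram (XYZ n)}

/-- A variable that is not queried does not matter. -/
theorem exists_label_eq {V : Type} {B : BranchingProgram V} {f : (V → Bool) → Bool}
    (hf : B.Computes f) {v : V} {a a' : V → Bool} (h : ∀ u, u ≠ v → a u = a' u)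
    (hne : f a ≠ f a') : ∃ u, B.label u = v := by
  by_contra! hv
  refine hne ?_
  have hstep : B.Step a = B.Step a' := by
    funext p q
    simp only [BranchingProgram.Step, h _ (hv _)]
  have h1 := hf a
  rw [hstep] at h1
  have hu : Relator.RightUnique (B.Step a') := by
    rintro _ _ _ ⟨u, rfl, rfl⟩ ⟨w, hw, rfl⟩
    cases hw; rfl
  have hs : ∀ {b c}, Relation.ReflTransGen (B.Step a') (Sum.inr b) (Sum.inr c) → b = c := by
    intro b c h
    rcases Relation.ReflTransGen.cases_head h with h | ⟨_, ⟨u, hu, _⟩, _⟩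
    · exact Sum.inr.inj h
    · cases hu
  rcases Relation.ReflTransGen.total_of_right_unique hu h1 (hf a') with h2 | h2
  · exact hs h2
  · exact (hs h2).symm

/-- The number of nodes from which a node can be reached increases along the edges. -/
theorem exists_rank (B : BranchingProgram (XYZ n)) :
    ∃ r : B.Node → ℕ, ∀ u b v, B.next u b = Sum.inl v → r u < r v := by
  have := B.finite_node
  refine ⟨fun v => Set.ncard
    {w | Relation.TransGen (fun v w => ∃ b, B.next v b = Sum.inl w) w v}, fun u b v h => ?_⟩
  refine Set.ncard_lt_ncard ⟨fun w hw => Relation.TransGen.tail hw ⟨b, h⟩, fun hsub => ?_⟩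
    (Set.toFinite _)
  exact B.acyclic u (hsub (Relation.TransGen.single ⟨b, h⟩))

/-- The successor function of `B`, its nodes being identified with their labels. -/
def nextOf (e : B.Node ≃ XYZ n) (v : XYZ n) (b : Bool) : XYZ n ⊕ Bool :=
  Sum.map e id (B.next (e.symm v) b)

theorem nextOf_eq (e : B.Node ≃ XYZ n) {u v : XYZ n} {b : Bool}
    (h : nextOf e u b = Sum.inl v) : B.next (e.symm u) b = Sum.inl (e.symm v) := by
  rw [nextOf] at h
  rcases hq : B.next (e.symm u) b with w | d
  · rw [hq, Sum.map_inl, Sum.inl.injEq] at h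
    rw [← h, Equiv.symm_apply_apply]
  · rw [hq] at h
    cases h

/-- An acyclic numbering in which the triplets come one after the other, every node being
numbered by a natural number below `3 * n`, puts the triplet at position `t` on the numbers
`3 * t`, `3 * t + 1`, `3 * t + 2`. -/
theorem TripleChain.rank_div {nx : XYZ n → Bool → XYZ n ⊕ Bool} {src : XYZ n ⊕ Bool}
    {s : ℕ → Fin n} {c : ℕ → Bool} {I : ℕ → Finset (Fin n)} {A : ℕ → Fin n}
    (T : TripleChain nx src s c I A) {r : XYZ n → ℕ} (hr : IsRank nx r)
    (hinj : Function.Injective r) (hlt : ∀ v, r v < 3 * n) {t : ℕ} (ht : t < n) {u : XYZ n}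
    (hu : u ∈ triple s A t) : r u / 3 = t := by
  have hxy : ∀ t, r (XYZ.x (A t)) ≠ r (XYZ.y (s t)) := fun t h => by cases hinj h
  have hxz : ∀ t, r (XYZ.x (A t)) ≠ r (XYZ.z (s t)) := fun t h => by cases hinj h
  have hyz : ∀ t, r (XYZ.y (s t)) ≠ r (XYZ.z (s t)) := fun t h => by cases hinj h
  have hx : ∀ t, XYZ.x (A t) ∈ triple s A t := x_mem_triple
  have hy : ∀ t, XYZ.y (s t) ∈ triple s A t := yz_mem_triple true
  have hz : ∀ t, XYZ.z (s t) ∈ triple s A t := yz_mem_triple false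
  have lower : ∀ t < n, ∀ u ∈ triple s A t, 3 * t ≤ r u := by
    intro t
    induction t with
    | zero => intros; omega
    | succ t ih =>
      intro ht u hu
      have h1 := ih (by omega) _ (hx t)
      have h2 := ih (by omega) _ (hy t)
      have h3 := ih (by omega) _ (hz t)
      have h4 := T.rank_lt_succ hr ht (hx t) hu
      have h5 := T.rank_lt_succ hr ht (hy t) hu
      have h6 := T.rank_lt_succ hr ht (hz t) hu
      have := hxy t
      have := hxz t
      have := hyz t
      omega
  have upper : ∀ k, ∀ t, t + k + 1 = n → ∀ u ∈ triple s A t, r u < 3 * (t + 1) := by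
    intro k
    induction k with
    | zero =>
      intro t ht u _
      have := hlt u
      omega
    | succ k ih =>
      intro t ht u hu
      have h1 := ih (t + 1) (by omega) _ (hx (t + 1))
      have h2 := ih (t + 1) (by omega) _ (hy (t + 1))
      have h3 := ih (t + 1) (by omega) _ (hz (t + 1))
      have h4 := T.rank_lt_succ hr (by omega) hu (hx (t + 1))
      have h5 := T.rank_lt_succ hr (by omega) hu (hy (t + 1))
      have h6 := T.rank_lt_succ hr (by omega) hu (hz (t + 1))
      have := hxy (t + 1)
      have := hxz (t + 1)
      have := hyz (t + 1)
      omega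
  have h1 := lower t ht u hu
  have h2 := upper (n - t - 1) t (by omega) u hu
  omega

theorem exists_perm_of_computesExtension (hn : Even n) (hn2 : n ≠ 2) (hG : BPIS.IsInstance G)
    (hB : B.OnceAppearance) (hγ : B.ComputesExtension (gammaG G)) :
    Nat.card B.Node = 3 * n ∧
      ∃ π : Equiv.Perm (Fin n),
        (∀ (N : ℕ) (ord : B.Node ≃ Fin N), B.IsTopologicalOrder ord →
          (∀ i < n, ∃ a b : Fin n, B.blockLabels ord i = {XYZ.x a, XYZ.y b, XYZ.z b}) ∧
          (∀ a b : Fin n, π b = a ↔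
            ∃ i < n, B.blockLabels ord i = {XYZ.x a, XYZ.y b, XYZ.z b})) ∧
        (∀ i : Fin n, InFirstHalf (π i) ↔ InFirstHalf i) ∧
        G.IsIndepSet {v | ∃ i : Fin n, v = (i, π i)} := by
  -- For `n = 0` there are no variables, and the assignment `(1, 0, 0)` also has `x = 0`.
  rcases Nat.eq_zero_or_pos n with rfl | hn0
  · have : IsEmpty (XYZ 0) := (xyzEquiv 0).isEmpty
    have : IsEmpty B.Node := Function.isEmpty B.label
    refine ⟨by simp, 1, fun N ord _ => ⟨fun i hi => by omega, fun a => a.elim0⟩,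
      fun i => i.elim0, ?_⟩
    rintro _ ⟨i, -⟩
    exact i.elim0
  obtain ⟨f, hf, hcomp⟩ := hγ
  have fM : f (asg false false true) = false :=
    hf _ _ ((gammaVec_x_zero fun _ => rfl).trans (by simp [asg]))
  have fMx : ∀ i, f (Function.update (asg false false true) (XYZ.x i) true) = true := fun i =>
    hf _ _ ((gammaVec_z_one hn0 fun j => by simp [asg]).trans (by
      simp only [Option.some.injEq, decide_eq_true_eq]
      exact ⟨i, by simp⟩))
  have fMy : ∀ i, f (Function.update (asg false false true) (XYZ.y i) true) = true := fun i =>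
    hf _ _ ((gammaVec_z_one hn0 fun j => by simp [asg]).trans (by
      simp only [Option.some.injEq, decide_eq_true_eq]
      exact ⟨i, by simp⟩))
  have fR : f (asg true false false) = false :=
    hf _ _ ((gammaVec_x_one hn0 fun _ => rfl).trans (by simp [asg]))
  have fRz : ∀ i, f (Function.update (asg true false false) (XYZ.z i) true) = true := fun i =>
    hf _ _ ((gammaVec_x_one hn0 fun j => by simp [asg]).trans (by
      simp only [Option.some.injEq, decide_eq_true_eq]
      exact ⟨i, by simp⟩))
  have hsurj : Function.Surjective B.label := by
    rintro (i | i | i)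
    · exact exists_label_eq hcomp (a := Function.update (asg false false true) (XYZ.x i) true)
        (a' := asg false false true) (fun u hu => by simp [hu]) (by simp [fM, fMx])
    · exact exists_label_eq hcomp (a := Function.update (asg false false true) (XYZ.y i) true)
        (a' := asg false false true) (fun u hu => by simp [hu]) (by simp [fM, fMy])
    · exact exists_label_eq hcomp (a := Function.update (asg true false false) (XYZ.z i) true)
        (a' := asg true false false) (fun u hu => by simp [hu]) (by simp [fR, fRz])
  set e : B.Node ≃ XYZ n := Equiv.ofBijective B.label ⟨hB, hsurj⟩ with he
  have hlab : ∀ u, e u = B.label u := fun _ => rfl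
  have hcard : Nat.card B.Node = 3 * n := (Nat.card_congr e).trans (card_xyz n)
  refine ⟨hcard, ?_⟩
  have hacc : ∀ a, Acc (nextOf e) a (Sum.map e id B.source) ↔ f a = true := by
    intro a
    have h1 : ∀ q, Relation.ReflTransGen (B.Step a) B.source q →
        Run (nextOf e) a (Sum.map e id B.source) (Sum.map e id q) := by
      intro q hq
      induction hq with
      | refl => exact .refl
      | tail _ h ih =>
        obtain ⟨u, rfl, rfl⟩ := h
        exact ih.tail ⟨e u, rfl, by rw [nextOf, Equiv.symm_apply_apply, hlab]⟩
    rw [acc_iff_of_run (h1 _ (hcomp a))]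
    exact acc_sink
  have H : Realizes (nextOf e) (Sum.map e id B.source) := by
    refine ⟨?_, ?_, ?_, ?_, ?_, ?_, ?_⟩
    · obtain ⟨r, hr⟩ := exists_rank B
      exact ⟨fun v => r (e.symm v), fun u b v h => hr _ b _ (nextOf_eq e h)⟩
    · intro a ha
      rw [hacc, hf a _ (gammaVec_x_zero ha)]
      simp
    · rw [hacc, fM]; simp
    · exact fun i => (hacc _).2 (fMx i)
    · exact fun i => (hacc _).2 (fMy i)
    · rw [hacc, fR]; simp
    · exact fun i => (hacc _).2 (fRz i)
  obtain ⟨s, c, I, A, T⟩ := H.exists_tripleChain hn0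
  have hsb : Function.Bijective fun t : Fin n => s t :=
    Finite.injective_iff_bijective.1 fun t t' h => Fin.ext (T.inj t t.2 t' t'.2 h)
  have hAb : Function.Bijective fun t : Fin n => A t :=
    Finite.injective_iff_bijective.1 fun t t' h => Fin.ext (T.A_inj t.2 t'.2 h)
  set π : Equiv.Perm (Fin n) := (Equiv.ofBijective _ hsb).symm.trans (Equiv.ofBijective _ hAb)
    with hπ
  have hπs : ∀ t (ht : t < n), π (s t) = A t := by
    intro t ht
    have : s t = Equiv.ofBijective _ hsb ⟨t, ht⟩ := rfl
    rw [hπ, Equiv.trans_apply, this, Equiv.symm_apply_apply]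
    rfl
  -- This forces the value of `γ_G` on the inputs used for the remaining two claims.
  have hzero : ∀ x z : Fin n → Bool, (∀ b, z b = true → x (π b) = false) →
      ∀ v, gammaVec G x (fun _ => false) z = some v → v = false := by
    intro x z hxz v hv
    set a : XYZ n → Bool := fun u => match u with
      | .x i => x i
      | .y _ => false
      | .z i => z i with ha
    rw [← hf a v hv, ← Bool.not_eq_true, ← hacc]
    exact T.not_acc (fun _ => rfl) fun t ht h => by
      rw [← hπs t ht]
      exact hxz _ h
  have hhalf : ∀ i, InFirstHalf i → InFirstHalf (π.symm i) := by
    classical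
    intro i hi
    have := hzero (fun j => decide (¬ InFirstHalf (π.symm j))) (fun j => decide (InFirstHalf j))
      (by simp) _ (gammaVec_half hn hn0 (by simp) fun _ => rfl)
    by_contra h
    rw [decide_eq_false_iff_not] at this
    exact this ⟨i, hi, by simpa using h⟩
  have hiff : ∀ i, InFirstHalf (π i) ↔ InFirstHalf i := by
    intro i
    refine ⟨fun h => by simpa using hhalf _ h, fun h => ?_⟩
    simpa using Equiv.Perm.perm_symm_on_of_perm_on_finite (f := π.symm)
      (p := fun i : Fin n => InFirstHalf i) hhalf h
  refine ⟨π, ?_, hiff, ?_⟩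
  · intro N ord hord
    have hN : N = 3 * n := by
      rw [← hcard, Nat.card_congr ord, Nat.card_fin]
    have hdiv : ∀ t < n, ∀ u ∈ triple s A t, (ord (e.symm u) : ℕ) / 3 = t := by
      intro t ht u hu
      exact T.rank_div (r := fun u => ord (e.symm u))
        (fun u b v h => hord _ _ b (nextOf_eq e h))
        (fun u v h => e.symm.injective (ord.injective (Fin.ext h)))
        (fun v => hN ▸ (ord (e.symm v)).2) ht hu
    have hblock : ∀ t < n, B.blockLabels ord t = triple s A t := by
      intro t ht
      ext v
      constructor
      · rintro ⟨u, hu, rfl⟩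
        obtain ⟨t', ht', hmem⟩ : ∃ t' < n, B.label u ∈ triple s A t' := by
          rcases eq_x_or_yz (B.label u) with ⟨i, hi⟩ | ⟨d, b, hb⟩
          · obtain ⟨t', ht', rfl⟩ := T.A_surj i
            exact ⟨t', ht', hi ▸ x_mem_triple t'⟩
          · obtain ⟨t', ht', rfl⟩ := T.surj b
            exact ⟨t', ht', hb ▸ yz_mem_triple d t'⟩
        have h1 := hdiv t' ht' _ hmem
        rw [← hlab, Equiv.symm_apply_apply] at h1
        have h2 : (ord u : ℕ) / 3 = t := hu
        rw [← h2, h1]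
        exact hmem
      · intro hv
        exact ⟨e.symm v, hdiv t ht v hv, by rw [← hlab, Equiv.apply_symm_apply]⟩
    refine ⟨fun t ht => ⟨A t, s t, hblock t ht⟩, fun a b => ⟨?_, ?_⟩⟩
    · rintro rfl
      obtain ⟨t, ht, rfl⟩ := T.surj b
      exact ⟨t, ht, by rw [hblock t ht, hπs t ht]; rfl⟩
    · rintro ⟨t, ht, h⟩
      rw [hblock t ht] at h
      have h1 : XYZ.x a ∈ triple s A t := h ▸ by simp
      have h2 : XYZ.y b ∈ triple s A t := h ▸ by simp
      simp only [triple, Set.mem_insert_iff, Set.mem_singleton_iff, XYZ.x.injEq, XYZ.y.injEq,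
        reduceCtorEq, or_false, false_or] at h1 h2
      rw [h1, h2, hπs t ht]
  · have hn3 : 2 < n := by
      obtain ⟨m, rfl⟩ := hn
      omega
    have key : ∀ j j', (j, π j) ∈ BPIS.J₁ n → (j', π j') ∈ BPIS.J₂ n →
        ¬ G.Adj (j, π j) (j', π j') := by
      intro j j' h1 h2 hadj
      have := hzero (fun i => !decide (i = π j ∨ i = π j')) (fun i => decide (i = j ∨ i = j'))
        (fun b hb => by
          rcases of_decide_eq_true hb with rfl | rfl <;> simp) true
        (gammaVec_edge hn3 ⟨j, π j, j', π j', h1, h2, hadj, fun i => by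
          rw [Bool.not_eq_false', decide_eq_true_eq], fun _ => rfl, by simp⟩)
      cases this
    rintro _ ⟨j, rfl⟩ _ ⟨j', rfl⟩ - hadj
    rcases hG _ _ hadj with ⟨h1, h2⟩ | ⟨h1, h2⟩
    · exact key j j' h1 h2 hadj
    · exact key j' j h2 h1 hadj.symm

end Structure

/-! ### From a permutation to a once-appearance program -/

section Construction

variable {n : ℕ} {G : SimpleGraph (Fin n × Fin n)}

/-- The node `z k`, which is the first node of the gadget of index `k`, or the sink labelled
`false` if there is no such gadget. -/
def gadgetEntry (n k : ℕ) : XYZ n ⊕ Bool :=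
  if h : k < n then Sum.inl (XYZ.z ⟨k, h⟩) else Sum.inr false

/-- Successors in the program that evaluates `z b ∧ (x (π b) ∨ y b)` for `b = 0, 1, …` and accepts
as soon as one of these formulas is true. -/
def gadgetNext (π : Equiv.Perm (Fin n)) : XYZ n → Bool → XYZ n ⊕ Bool
  | .z b, false => gadgetEntry n (b + 1)
  | .z b, true => Sum.inl (.x (π b))
  | .x a, false => Sum.inl (.y (π.symm a))
  | .x _, true => Sum.inr true
  | .y b, false => gadgetEntry n (b + 1)
  | .y _, true => Sum.inr true

/-- A topological numbering of the gadget program. -/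
def gadgetRank (π : Equiv.Perm (Fin n)) : XYZ n → ℕ
  | .z b => 3 * b
  | .x a => 3 * (π.symm a) + 1
  | .y b => 3 * b + 2

theorem gadgetEntry_eq {k : ℕ} {v : XYZ n} (h : gadgetEntry n k = Sum.inl v) :
    ∃ hk : k < n, v = XYZ.z ⟨k, hk⟩ := by
  rw [gadgetEntry] at h
  split_ifs at h with hk
  exact ⟨hk, (Sum.inl.inj h).symm⟩

theorem isRank_gadgetRank (π : Equiv.Perm (Fin n)) : IsRank (gadgetNext π) (gadgetRank π) := by
  rintro (a | b | b) (_ | _) v h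
  · cases h
    simp [gadgetRank]
  · cases h
  · obtain ⟨hk, rfl⟩ := gadgetEntry_eq h
    simp only [gadgetRank]; omega
  · cases h
  · obtain ⟨hk, rfl⟩ := gadgetEntry_eq h
    simp only [gadgetRank]; omega
  · cases h
    simp [gadgetRank]

/-- The gadget program of `π`. -/
def gadgetProgram (π : Equiv.Perm (Fin n)) : BranchingProgram (XYZ n) where
  Node := XYZ n
  finite_node := inferInstance
  label := id
  next := gadgetNext π
  source := gadgetEntry n 0
  acyclic u h := by
    have : ∀ v, Relation.TransGen (fun v w => ∃ b, gadgetNext π v b = Sum.inl w) u v →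
        gadgetRank π u < gadgetRank π v := by
      intro v hv
      induction hv with
      | single h => exact h.elim fun b hb => isRank_gadgetRank π _ b _ hb
      | tail _ h ih => exact ih.trans (h.elim fun b hb => isRank_gadgetRank π _ b _ hb)
    exact lt_irrefl _ (this u h)
  source_iff u := by
    constructor
    · intro h
      rcases u with a | b | ⟨_ | k, hk⟩
      · exact absurd (congrArg Sum.inl (congrArg XYZ.x (π.apply_symm_apply a)))
          (h (.z (π.symm a)) true)
      · exact absurd (congrArg Sum.inl (congrArg XYZ.y (π.symm_apply_apply b)))
          (h (.x (π b)) false)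
      · exact dif_pos hk
      · exact absurd (dif_pos hk) (h (.z ⟨k, by omega⟩) false)
    · intro h v b hv
      obtain ⟨h0, rfl⟩ := gadgetEntry_eq h
      have := isRank_gadgetRank π _ _ _ hv
      simp [gadgetRank] at this

theorem gadgetProgram_computes (π : Equiv.Perm (Fin n)) :
    (gadgetProgram π).Computes fun a => decide
      (∃ b, a (XYZ.z b) = true ∧ (a (XYZ.x (π b)) = true ∨ a (XYZ.y b) = true)) := by
  intro a
  have key : ∀ m k, k + m = n → Run (gadgetNext π) a (gadgetEntry n k) (Sum.inr (decide
      (∃ b : Fin n, k ≤ b ∧ a (XYZ.z b) = true ∧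
        (a (XYZ.x (π b)) = true ∨ a (XYZ.y b) = true)))) := by
    intro m
    induction m with
    | zero =>
      intro k hk
      rw [gadgetEntry, dif_neg (by omega), decide_eq_false]
      rintro ⟨b, hb, -⟩
      omega
    | succ m ih =>
      intro k hk
      have hkn : k < n := by omega
      rw [gadgetEntry, dif_pos hkn]
      set b : Fin n := ⟨k, hkn⟩ with hb
      have hrec := ih (k + 1) (by omega)
      by_cases hg : a (XYZ.z b) = true ∧ (a (XYZ.x (π b)) = true ∨ a (XYZ.y b) = true)
      · rw [decide_eq_true ⟨b, le_rfl, hg⟩]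
        refine (run_next hg.1).trans ?_
        change Run _ _ (Sum.inl (XYZ.x (π b))) _
        cases hx : a (XYZ.x (π b))
        · refine (run_next hx).trans ?_
          simp only [gadgetNext, Equiv.symm_apply_apply]
          exact run_next (hg.2.resolve_left (by simp [hx]))
        · exact run_next hx
      · have heq : (∃ b : Fin n, k ≤ b ∧ a (XYZ.z b) = true ∧
            (a (XYZ.x (π b)) = true ∨ a (XYZ.y b) = true)) ↔
            ∃ b : Fin n, k + 1 ≤ b ∧ a (XYZ.z b) = true ∧
            (a (XYZ.x (π b)) = true ∨ a (XYZ.y b) = true) := by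
          constructor
          · rintro ⟨d, hd, hd'⟩
            refine ⟨d, lt_of_le_of_ne hd fun h => hg ?_, hd'⟩
            rwa [show b = d from Fin.ext h]
          · rintro ⟨d, hd, hd'⟩
            exact ⟨d, by omega, hd'⟩
        simp only [heq]
        refine Relation.ReflTransGen.trans ?_ hrec
        cases hz : a (XYZ.z b)
        · exact run_next hz
        · simp only [hz, true_and, not_or, Bool.not_eq_true] at hg
          refine ((run_next hz).trans ?_)
          change Run _ _ (Sum.inl (XYZ.x (π b))) _
          refine (run_next hg.1).trans ?_
          simp only [gadgetNext, Equiv.symm_apply_apply]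
          exact run_next hg.2
  have h := key n 0 (by omega)
  simp only [Nat.zero_le, true_and] at h
  exact h

/-- The gadget program of a permutation `π` that preserves the halves computes `γ_G` if the
vertices `(i, π i)` are independent. -/
theorem gadgetProgram_computesExtension {π : Equiv.Perm (Fin n)}
    (hπ : ∀ i, InFirstHalf (π i) ↔ InFirstHalf i)
    (hind : ∀ i j, ¬ G.Adj (i, π i) (j, π j)) :
    (gadgetProgram π).ComputesExtension (gammaG G) := by
  refine ⟨_, fun a v h => ?_, gadgetProgram_computes π⟩
  simp only [gammaG, gammaVec] at h
  split_ifs at h with h1 h2 h3 h4 h5 h6 h7 <;> rw [← Option.some.inj h] <;>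
    simp only [decide_eq_decide, decide_eq_true_eq, decide_eq_false_iff_not]
  · simp [h1, and_comm]
  · simp [h2]
  · simp only [h3, true_and, exists_or]
    exact or_congr ⟨fun ⟨b, hb⟩ => ⟨_, hb⟩, fun ⟨i, hi⟩ => ⟨π.symm i, by simpa using hi⟩⟩ Iff.rfl
  · simp [h4]
  · simp only [h5.1, h5.2, Bool.false_eq_true, or_false]
    exact ⟨fun ⟨b, hb, hx⟩ => ⟨_, (hπ b).2 hb, hx⟩,
      fun ⟨i, hi, hx⟩ => ⟨π.symm i, (hπ _).1 (by simpa using hi), by simpa using hx⟩⟩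
  · simp only [h6.1, h6.2, Bool.false_eq_true, or_false]
    exact ⟨fun ⟨b, hb, hx⟩ => ⟨_, fun h => hb ((hπ b).1 h), hx⟩,
      fun ⟨i, hi, hx⟩ => ⟨π.symm i, fun h => hi (by simpa using (hπ _).2 h), by simpa using hx⟩⟩
  · obtain ⟨j, k, j', k', hJ, hJ', hadj, hx, -, hz⟩ := h7
    by_contra hno
    simp only [not_exists, not_and, not_or, Bool.not_eq_true] at hno
    have h8 := (hx _).1 (hno j ((hz j).2 (Or.inl rfl))).1
    have h9 := (hx _).1 (hno j' ((hz j').2 (Or.inr rfl))).1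
    have h10 : π j = k := h8.resolve_right fun h => hJ'.2 (h ▸ (hπ j).2 hJ.1)
    have h11 : π j' = k' := h9.resolve_left fun h => hJ'.1 ((hπ j').1 (h ▸ hJ.2))
    exact hind j j' (by rwa [h10, h11])

/-- The independent set of a yes-instance has one element in each row, as it has `n` elements and
meets every row; so it is the graph of a permutation. -/
theorem exists_perm_of_isYes (h : BPIS.IsYes G) : ∃ π : Equiv.Perm (Fin n),
    (∀ i, InFirstHalf (π i) ↔ InFirstHalf i) ∧ ∀ i j, ¬ G.Adj (i, π i) (j, π j) := by
  classical
  obtain ⟨S, hS, hcard, hind, hrow⟩ := h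
  choose p q hp using hrow
  have himg : Finset.univ.image (fun i => (i, p i)) = S := by
    refine Finset.eq_of_subset_of_card_le (fun v hv => ?_) ?_
    · obtain ⟨i, -, rfl⟩ := Finset.mem_image.1 hv
      exact (hp i).1
    · rw [hcard, Finset.card_image_of_injective _ fun i j h => (Prod.mk.inj h).1, Finset.card_fin]
  have hsurj : Function.Surjective p := by
    intro i
    have := (hp i).2
    rw [← himg] at this
    obtain ⟨j, -, hj⟩ := Finset.mem_image.1 this
    exact ⟨j, (Prod.mk.inj hj).2⟩
  refine ⟨Equiv.ofBijective p (Finite.surjective_iff_bijective.1 hsurj), fun i => ?_,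
    fun i j hadj => hind (hp i).1 (hp j).1 hadj.ne hadj⟩
  change InFirstHalf (p i) ↔ InFirstHalf i
  rcases hS (hp i).1 with h | h
  · exact iff_of_true h.2 h.1
  · exact iff_of_false h.2 h.1

theorem isYes_of_perm {π : Equiv.Perm (Fin n)} (hπ : ∀ i, InFirstHalf (π i) ↔ InFirstHalf i)
    (hind : G.IsIndepSet {v | ∃ i : Fin n, v = (i, π i)}) : BPIS.IsYes G := by
  classical
  refine ⟨Finset.univ.image fun i => (i, π i), ?_, ?_, ?_, fun i => ⟨π i, π.symm i, ?_, ?_⟩⟩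
  · intro v hv
    obtain ⟨i, -, rfl⟩ := Finset.mem_image.1 hv
    by_cases h : InFirstHalf i
    · exact Or.inl ⟨h, (hπ i).2 h⟩
    · exact Or.inr ⟨h, fun h' => h ((hπ i).1 h')⟩
  · rw [Finset.card_image_of_injective _ fun i j h => (Prod.mk.inj h).1, Finset.card_fin]
  · convert hind using 1
    ext v
    simp [eq_comm]
  · exact Finset.mem_image.2 ⟨i, Finset.mem_univ _, rfl⟩
  · exact Finset.mem_image.2 ⟨π.symm i, Finset.mem_univ _, by simp⟩

end Construction

end OnceProgram

theorem mainTheorem2 (n : ℕ) (hn : Even n) (hn2 : n ≠ 2)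
    (G : SimpleGraph (Fin n × Fin n)) (hG : BPIS.IsInstance G) :
    (BPIS.IsYes G ↔
      ∃ B : BranchingProgram (XYZ n), B.OnceAppearance ∧ B.ComputesExtension (gammaG G)) ∧
    (∀ B : BranchingProgram (XYZ n), B.OnceAppearance → B.ComputesExtension (gammaG G) →
      Nat.card B.Node = 3 * n ∧
      ∃ π : Equiv.Perm (Fin n),
        (∀ (N : ℕ) (ord : B.Node ≃ Fin N), B.IsTopologicalOrder ord →
          (∀ i < n, ∃ a b : Fin n, B.blockLabels ord i = {XYZ.x a, XYZ.y b, XYZ.z b}) ∧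
          (∀ a b : Fin n, π b = a ↔
            ∃ i < n, B.blockLabels ord i = {XYZ.x a, XYZ.y b, XYZ.z b})) ∧
        (∀ i : Fin n, InFirstHalf (π i) ↔ InFirstHalf i) ∧
        G.IsIndepSet {v | ∃ i : Fin n, v = (i, π i)}) := by
  refine ⟨⟨fun h => ?_, ?_⟩, fun B hB hγ =>
    OnceProgram.exists_perm_of_computesExtension hn hn2 hG hB hγ⟩
  · obtain ⟨π, h1, h2⟩ := OnceProgram.exists_perm_of_isYes h
    exact ⟨OnceProgram.gadgetProgram π, fun _ _ h => h,
      OnceProgram.gadgetProgram_computesExtension h1 h2⟩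
  · rintro ⟨B, hB, hγ⟩
    obtain ⟨-, π, -, h1, h2⟩ := OnceProgram.exists_perm_of_computesExtension hn hn2 hG hB hγ
    exact OnceProgram.isYes_of_perm h1 h2
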